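/- **Setting.** There are $n$ players, of whom fewer than $n/3$ are malicious; let $h$ be the ratio (number of honest players)$/n$. The network is complete, with private channels, and synchronous: in each communication step every player sends one message to every player (itself included). Let $V$ be a set with $\bot\notin V$, let $m\ge 0$, and let player $i$ start with a vector $v'_i\in(V\cup\{\bot\})^m$. A component $c$ is *ambiguous* if two honest players start with distinct $c$-th components; $l$ is the number of ambiguous components. $\#_i(v,c)$ denotes the number of players from whom $i$ receives, in the current step, a valid vector with $c$-th component $v$ (invalid messages are discarded). **The MBA protocol** (as followed by each honest player $i$). *Graded consensus* (two communication steps). Step 1: send $v'_i$. Step 2: send $\tilde v_i$, where $\tilde v_{i,c}=v$ if $\#_i(v,c)\ge\lfloor 2n/3\rfloor+1$ in Step 1, and $\tilde v_{i,c}=\bot$ if there is no such $v$. Then put $(v_{i,c},g_{i,c})=(x,2)$ if $\#_i(x,c)\ge\lfloor 2n/3\rfloor+1$ in Step 2 for some $x\ne\bot$; otherwise $(x,1)$ if $\#_i(x,c)\ge\lfloor n/3\rfloor+1$ for some $x\neq\bot$; otherwise $(\bot,0)$. *Binary agreement.* Start with $\gamma=0$, $f_i=\mathbf 0$, and $b_{i,c}=0$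 if $g_{i,c}=2$, $b_{i,c}=1$ otherwise. As soon as $f_i=\mathbf 1$, player $i$ sends $b_i\star$ in the next communication step and halts (a vector $v\star$ received from $j$ counts as $j$'s vector in that step and in all later ones). Until then, repeat the following three steps, in each of which $i$ sends $b_i$ and updates only the components $c$ with $f_{i,c}=0$. 1. If $\#_i(0,c)>\frac23n$, set $b_{i,c}=0$, $f_{i,c}=1$; else if $\#_i(1,c)>\frac23n$, set $b_{i,c}=1$; else set $b_{i,c}=0$. 2. If $\#_i(1,c)>\frac23n$, set $b_{i,c}=1$, $f_{i,c}=1$; else if $\#_i(0,c)>\frac23n$, set $b_{i,c}=0$; else set $b_{i,c}=1$. 3. Player $i$ also sends its signature $s_i=\mathrm{SIG}_i(r\|\gamma)$, where $r$ is a common random string; a vector that is not final and comes without the sender's correct signature is invalid. If $\#_i(0,c)>\frac23n$, set $b_{i,c}=0$; else if $\#_i(1,c)>\frac23n$, set $b_{i,c}=1$; else set $b_{i,c}=k_c$, the $c$-th bit of $k=H(\min_{j\in P_i}H(s_j))$, where $P_i$ is the set of players from whom $i$ has just received a valid signed vector, and the minimum is lexicographic. Then increase $\gamma$ by $1$. **Idealisations.**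 Signatures are unique (one per player and $\gamma$) and unforgeable. $H$ is a random oracle with infinite output: the strings $H(s)$ and $H(H(s))$, for the signatures $s$ of all players and all $\gamma$, are independent sequences of independent fair bits. The set of malicious players and the initial vectors are fixed. The malicious players act jointly and adaptively with unbounded computing power and private randomness independent of $H$, and may send different messages, or none, to different players. In each step they choose their messages with knowledge of everything that the honest players have sent so far, including in the current step, and of the values $H(s)$, $H(H(s))$ for all their own signatures $s$ (for every $\gamma$) and for the honest signatures of every $\gamma$ whose step 3 has been reached, including the current step, but of no others. **The random variable $\chi_{l,\pi}$.** Start with $l$ coins; in each step flip all remaining coins independently, each showing heads with probability $\pi$, and discard those that show heads. $\chi_{l,\pi}$ is the number of steps until no coin is left (so $\chi_{0,\pi}=0$). **Corollary (Number of Communication Steps).** Let $N\in\mathbb N\cup\{\infty\}$ be the number of communication steps of the run until all honest players have halted: the two steps of graded consensus and all steps of binary agreement, up to and including the one in which the last honest player sends its final vector $b_i\star$. Then, for every strategy of the malicious players, $N$ is stochastically upper bounded by $5+3\chi_{l,h/2}$, that is, $$\Pr(N>k)\;\le\;\Pr\bigl(5+3\chi_{l,h/2}>k\bigr)\qquad\text{for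 every } k .$$ -/

import Mathlib

open MeasureTheory ProbabilityTheory

noncomputable section

namespace MBA

/-! ## Stochastic upper bounds and the coin game -/

/-- `X` (a random variable on `(Ω, μ)`) is stochastically upper bounded by `Y`
(a random variable on `(Ω', ν)`): `P (X > k) ≤ P (Y > k)` for every `k`. -/
def StochBoundedBy {Ω Ω' : Type*} [MeasurableSpace Ω] [MeasurableSpace Ω']
    (X : Ω → ℕ∞) (μ : Measure Ω) (Y : Ω' → ℕ∞) (ν : Measure Ω') : Prop :=
  ∀ k : ℕ∞, μ {ω | k < X ω} ≤ ν {ω | k < Y ω}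

/-- Outcomes of the game with `l` coins: `x w c = true` means that coin `c` shows heads in its
`(w+1)`-st flip. -/
abbrev Flips (l : ℕ) : Type := ℕ → Fin l → Bool

/-- All flips are independent and each shows heads with probability `p`. -/
def flipLaw (l : ℕ) (p : unitInterval) : Measure (Flips l) :=
  Measure.infinitePi fun _ : ℕ => Measure.pi fun _ : Fin l => bernoulliMeasure true false p

/-- The coins still in the game after `w` steps: in each step the remaining coins are flipped and
those that show heads are discarded. -/
def remaining {l : ℕ} (x : Flips l) : ℕ → Finset (Fin l)
  | 0 => Finset.univ
  | w + 1 => (remaining x w).filter fun c => x w c = false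

/-- The number `χ` of steps until no coins are left (`⊤` if this never happens). -/
def chi {l : ℕ} (x : Flips l) : ℕ∞ :=
  ⨅ (w : ℕ) (_ : remaining x w = ∅), (w : ℕ∞)

/-! ## Signatures and the random oracle -/

/-- Bit strings put out by the random oracle; they are idealised to be infinite. -/
abbrev BitString : Type := ℕ → Bool

/-- `⟨j, γ⟩` is the unique signature `SIG_j (r ‖ γ)` of the player `j` on the common random
string `r` followed by the counter `γ`. -/
@[ext] structure Signature (n : ℕ) where
  signer : Fin n
  counter : ℕ
  deriving DecidableEq

/-- The queries to the random oracle `H` that occur in the protocol: the signatures `σ`, and the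
strings `H σ`. -/
inductive Query (n : ℕ) where
  /-- asks for `H σ` -/
  | ofSig (σ : Signature n)
  /-- asks for `H (H σ)` -/
  | ofHash (σ : Signature n)

/-- A table of all answers of the random oracle. -/
abbrev Oracle (n : ℕ) : Type := Query n → BitString

/-- The law of an infinite sequence of independent fair bits. -/
def uniformBits : Measure BitString :=
  Measure.infinitePi fun _ : ℕ => (PMF.uniformOfFintype Bool).toMeasure

/-- The random oracle: the answers to distinct queries are independent and uniformly distributed.
(Almost surely the strings `H σ` are pairwise distinct, so that the queries are distinct.) -/
def oracleLaw (n : ℕ) : Measure (Oracle n) :=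
  Measure.infinitePi fun _ : Query n => uniformBits

/-- `H (SIG_j (r ‖ γ))`, as an element of the lexicographically ordered set of bit strings. -/
def sigHash {n : ℕ} (H : Oracle n) (γ : ℕ) (j : Fin n) : Lex (ℕ → Bool) :=
  toLex (H (.ofSig ⟨j, γ⟩))

/-- The bit `k_c` of `k = H (min_{j ∈ P} H (SIG_j (r ‖ γ)))`, where `1` is `true`. -/
def commonCoin {n : ℕ} (H : Oracle n) (γ : ℕ) (P : Set (Fin n)) (c : ℕ) : Bool :=
  open Classical in
  decide (∃ p ∈ P, (∀ j ∈ P, sigHash H γ p ≤ sigHash H γ j) ∧ H (.ofHash ⟨p, γ⟩) c = true)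

/-! ## Messages, the adversary, and its information

The rounds (communication steps) are numbered `t = 0, 1, 2, …`: the rounds `0` and `1` are the two
steps of the graded consensus, and round `2 + s` is step number `s` of the binary agreement,
that is STEP `s % 3 + 1` of the iteration with counter `γ = s / 3`.
Values in `V ∪ {⊥}` are elements of `Option V`; the bits `0`, `1` are `false`, `true`. -/

/-- The well-formed messages. -/
inductive Msg (n m : ℕ) (V : Type*) where
  /-- a vector of values (graded consensus) -/
  | values (v : Fin m → Option V)
  /-- a bit vector (STEPS 1 and 2 of the binary agreement) -/
  | vote (b : Fin m → Bool)
  /-- a bit vector with a signature (STEP 3 of the binary agreement) -/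
  | signedVote (b : Fin m → Bool) (σ : Signature n)
  /-- a bit vector marked as final, `b ⋆` -/
  | final (b : Fin m → Bool)

/-- The part of the oracle table known to the malicious players when they send in round `t`:
everything about their own signatures, and everything about the honest signatures for the counters
`γ` whose STEP 3 (round `3 * γ + 4`) has been reached. -/
def known {n : ℕ} (mal : Finset (Fin n)) (t : ℕ) (H : Oracle n) : Oracle n :=
  open Classical in
  fun q =>
    match q with
    | .ofSig σ => if σ.signer ∈ mal ∨ 3 * σ.counter + 4 ≤ t then H q else fun _ => false
    | .ofHash σ => if σ.signer ∈ mal ∨ 3 * σ.counter + 4 ≤ t then H q else fun _ => false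

/-- A strategy of the malicious players, who act jointly, adaptively, with unbounded computing
power and with private randomness in `S`.
`act t (s, K) j i` is the message that the malicious player `j` sends to `i` in round `t`
(`none`: nothing, or nothing valid), given the private randomness `s` and the known part `K` of the
oracle table. The states of the honest players at the start of round `t`, and hence all that they
have sent up to and including this round, are functions of `(s, K)`, so that the malicious players
may also react to all honest messages of the current and the earlier rounds.
Messages carry the discrete sigma-algebra. -/
structure Strategy (n m : ℕ) (V : Type*) (S : Type*) [MeasurableSpace S] where
  act : ℕ → S × Oracle n → Fin n → Fin n → Option (Msg n m V)
  measurable_act : ∀ (t : ℕ) (B : Set (Fin n → Fin n → Option (Msg n m V))),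
    MeasurableSet (act t ⁻¹' B)

/-! ## The protocol -/

/-- `#_i (v, c)`, when `recv j` is the valid vector received from `j`, if any: the number of players
`j` from whom a vector with `c`-th component `v` was received. -/
def count {n m : ℕ} {α : Type*} (recv : Fin n → Option (Fin m → α)) (v : α) (c : Fin m) : ℕ :=
  Set.ncard {j : Fin n | ∃ w, recv j = some w ∧ w c = v}

section Protocol

variable {n m : ℕ} {V S : Type*} [MeasurableSpace S]

/-- What `i` receives from `j` in round `t`, if an honest `j` would send `own`. -/
def delivered (mal : Finset (Fin n)) (A : Strategy n m V S) (ω : S × Oracle n) (t : ℕ)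
    (own : Fin n → Option (Msg n m V)) (i j : Fin n) : Option (Msg n m V) :=
  open Classical in
  if j ∈ mal then A.act t (ω.1, known mal t ω.2) j i else own j

/-- In the graded consensus only vectors of values are valid messages. -/
def Msg.toValues : Option (Msg n m V) → Option (Fin m → Option V)
  | some (.values v) => some v
  | _ => none

/-! ### Graded consensus -/

/-- The vectors received by `i` in STEP 1, in which every honest player sends its initial vector. -/
def gcRecv1 (mal : Finset (Fin n)) (init : Fin n → Fin m → Option V) (A : Strategy n m V S)
    (ω : S × Oracle n) (i j : Fin n) : Option (Fin m → Option V) :=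
  Msg.toValues (delivered mal A ω 0 (fun j => some (.values (init j))) i j)

/-- The vector that an honest player `i` sends in STEP 2. -/
def gcVec2 (mal : Finset (Fin n)) (init : Fin n → Fin m → Option V) (A : Strategy n m V S)
    (ω : S × Oracle n) (i : Fin n) (c : Fin m) : Option V :=
  open Classical in
  if h : ∃ v : Option V, 2 * n / 3 + 1 ≤ count (gcRecv1 mal init A ω i) v c then h.choose else none

/-- The vectors received by `i` in STEP 2. -/
def gcRecv2 (mal : Finset (Fin n)) (init : Fin n → Fin m → Option V) (A : Strategy n m V S)
    (ω : S × Oracle n) (i j : Fin n) : Option (Fin m → Option V) :=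
  Msg.toValues (delivered mal A ω 1 (fun j => some (.values (gcVec2 mal init A ω j))) i j)

/-- The value-grade pair `(v_{i,c}, g_{i,c})` put out by the graded consensus. -/
def gcOutput (mal : Finset (Fin n)) (init : Fin n → Fin m → Option V) (A : Strategy n m V S)
    (ω : S × Oracle n) (i : Fin n) (c : Fin m) : Option V × ℕ :=
  open Classical in
  if h : ∃ x : V, 2 * n / 3 + 1 ≤ count (gcRecv2 mal init A ω i) (some x) c then
    (some h.choose, 2)
  else if h : ∃ x : V, n / 3 + 1 ≤ count (gcRecv2 mal init A ω i) (some x) c then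
    (some h.choose, 1)
  else (none, 0)

/-! ### Binary agreement -/

/-- The local state of a player during the binary agreement. -/
structure PlayerState (n m : ℕ) where
  /-- the bit vector `b_i` -/
  bits : Fin m → Bool
  /-- the vector `f_i`: which components are finalized -/
  fin : Fin m → Bool
  /-- whether the player has sent `b_i ⋆`, has put out `b_i` and has halted -/
  halted : Bool
  /-- the final vector `v` received from `j` as `v ⋆`, if any -/
  starred : Fin n → Option (Fin m → Bool)

/-- The EXIT CHECK: all components are finalized. -/
def PlayerState.Exits (p : PlayerState n m) : Prop := ∀ c, p.fin c = true

/-- The message sent by an honest player `j` in step `s` of the binary agreement: nothing after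
halting, `b_j ⋆` if all components were finalized in the preceding step, otherwise `b_j`, in STEP 3
together with the signature on the current counter. -/
def honestMsg (s : ℕ) (j : Fin n) (p : PlayerState n m) : Option (Msg n m V) :=
  open Classical in
  if p.halted = true then none
  else if p.Exits then some (.final p.bits)
  else if s % 3 = 2 then some (.signedVote p.bits ⟨j, s / 3⟩)
  else some (.vote p.bits)

/-- The bit vector that a player in state `p` counts for `j` in step `s` after receiving `msg`
from `j`: the vector that `j` has declared final earlier, otherwise the vector in `msg`, provided
that `msg` is valid (in STEP 3 it must carry the signature of `j` on the current counter, unless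
it is final). -/
def counted (s : ℕ) (p : PlayerState n m) (msg : Fin n → Option (Msg n m V)) (j : Fin n) :
    Option (Fin m → Bool) :=
  match p.starred j with
  | some b => some b
  | none =>
    match msg j with
    | some (.final b) => some b
    | some (.vote b) => if s % 3 = 2 then none else some b
    | some (.signedVote b σ) => if s % 3 = 2 ∧ σ = ⟨j, s / 3⟩ then some b else none
    | _ => none

/-- The set `P_i` of the players whose signature on the current counter `γ = s / 3` is received with
a valid message in STEP 3. -/
def validSigners (s : ℕ) (p : PlayerState n m) (msg : Fin n → Option (Msg n m V)) : Set (Fin n) :=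
  {j | p.starred j = none ∧ ∃ b, msg j = some (.signedVote b ⟨j, s / 3⟩)}

/-- The new pair `(b_{i,c}, f_{i,c})` of a running player after step `s`, for a component with
`f_{i,c} = 0`. -/
def newBit (H : Oracle n) (s : ℕ) (p : PlayerState n m) (msg : Fin n → Option (Msg n m V))
    (c : Fin m) : Bool × Bool :=
  let zeros := count (counted s p msg) false c
  let ones := count (counted s p msg) true c
  if s % 3 = 0 then
    -- Coin-Fixed-To-0
    if 2 * n < 3 * zeros then (false, true)
    else if 2 * n < 3 * ones then (true, false)
    else (false, false)
  else if s % 3 = 1 then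
    -- Coin-Fixed-To-1
    if 2 * n < 3 * ones then (true, true)
    else if 2 * n < 3 * zeros then (false, false)
    else (true, false)
  else
    -- Coin-Genuinely-Flipped
    if 2 * n < 3 * zeros then (false, false)
    else if 2 * n < 3 * ones then (true, false)
    else (commonCoin H (s / 3) (validSigners s p msg) c, false)

/-- The state of an honest player after step `s` of the binary agreement. -/
def update (H : Oracle n) (s : ℕ) (p : PlayerState n m) (msg : Fin n → Option (Msg n m V)) :
    PlayerState n m :=
  open Classical in
  if p.halted = true then p
  else if p.Exits then { p with halted := true }
  else
    { bits := fun c => if p.fin c = true then p.bits c else (newBit H s p msg c).1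
      fin := fun c => if p.fin c = true then true else (newBit H s p msg c).2
      halted := false
      starred := fun j =>
        match p.starred j, msg j with
        | some b, _ => some b
        | none, some (.final b) => some b
        | none, _ => none }

/-- The state of the player `i` after `s` steps of the binary agreement, in the run with outcome
`ω` (meaningful for honest players; those in `mal` send what the strategy dictates). Initially
`b_{i,c} = 0` if `g_{i,c} = 2`, and `b_{i,c} = 1` otherwise. -/
def state (mal : Finset (Fin n)) (init : Fin n → Fin m → Option V) (A : Strategy n m V S)
    (ω : S × Oracle n) : ℕ → Fin n → PlayerState n m
  | 0 => fun i =>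
    { bits := fun c => if (gcOutput mal init A ω i c).2 = 2 then false else true
      fin := fun _ => false
      halted := false
      starred := fun _ => none }
  | s + 1 => fun i =>
    update ω.2 s (state mal init A ω s i)
      (delivered mal A ω (2 + s) (fun j => honestMsg s j (state mal init A ω s j)) i)

/-- The number of communication steps of the run: the two steps of the graded consensus and the
steps of the binary agreement up to and including the one in which the last honest player sends its
final vector and halts (`⊤` if some honest player never halts). -/
def commSteps (mal : Finset (Fin n)) (init : Fin n → Fin m → Option V) (A : Strategy n m V S)
    (ω : S × Oracle n) : ℕ∞ :=
  ⨅ (s : ℕ) (_ : ∀ i, i ∉ mal → (state mal init A ω s i).halted = true), ((2 + s : ℕ) : ℕ∞)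

/-- The number `l` of ambiguous components: those on which two honest players start with distinct
values. -/
def numAmbiguous (mal : Finset (Fin n)) (init : Fin n → Fin m → Option V) : ℕ :=
  Set.ncard {c : Fin m | ∃ i j, i ∉ mal ∧ j ∉ mal ∧ init i c ≠ init j c}

end Protocol

/-! ## The ratio of honest players -/

/-- The ratio `h` of honest players. -/
def honestRatio {n : ℕ} (mal : Finset (Fin n)) : ℝ := ((malᶜ).card : ℝ) / n

theorem honestRatio_half_mem {n : ℕ} (mal : Finset (Fin n)) :
    honestRatio mal / 2 ∈ unitInterval := by
  have h0 : (0 : ℝ) ≤ honestRatio mal := by unfold honestRatio; positivity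
  have h1 : honestRatio mal ≤ 1 := by
    unfold honestRatio
    apply div_le_one_of_le₀ _ (Nat.cast_nonneg n)
    exact_mod_cast (Finset.card_le_univ (malᶜ)).trans (by simp)
  exact ⟨by linarith, by linarith⟩

end MBA

end

noncomputable section

namespace MBA

/-! ## Counting votes -/

section Counting

variable {n m : ℕ} {α : Type*}

/-! Fewer than n/3 votes are malicious, so honest agreement on a component is never lost. Agreement
at the start of an iteration leads to finalization in one of its two fixed-coin steps (`Agree.fin`).
If every component is agreed after W iterations, the run takes at most 5 + 3W steps: two of graded
consensus, 3W, two to finalize, one to send the final vectors. Unambiguous components are agreed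
from the start.

For an ambiguous component the honest votes before STEP 3 single out a bit, `target`, whose opposite
no honest player can see with more than 2n/3 votes. If an honest player has the least signature
hash, all honest players who need the coin use that player's, however malicious signatures are
distributed. They then agree as soon as its bit equals the target (`agree_of_coin`).

The adversary influences the target, but only with knowledge that excludes the honest `H (H σ)` of
the current iteration. Fix everything except the honest `H (H σ)`. The leaders are then fixed, each
target depends only on earlier iterations, and the leaders' coins XORed with the targets are
independent fair bits (`measurePreserving_leaderBits`). With K honest leaders among W iterations,
all l ambiguous components have met their target with conditional probability (1 - 2^{-K})^l.

The components share the leaders and are therefore not independent, unlike the coins of the game.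
Honest leaders occur independently with probability h, so 2^{-K} has mean (1 - h/2)^W, and Jensen's
inequality for x^l bounds the mean of (1 - 2^{-K})^l below by (1 - (1 - h/2)^W)^l, the probability
that the game ends within W steps. -/

open Classical in
/-- The number of honest players `j` with `x j = v`. -/
def honestCount (mal : Finset (Fin n)) (x : Fin n → α) (v : α) : ℕ :=
  ((malᶜ).filter fun j => x j = v).card

theorem count_add_count_le (recv : Fin n → Option (Fin m → α)) (c : Fin m) {v w : α}
    (h : v ≠ w) : count recv v c + count recv w c ≤ n := by
  unfold count
  rw [← Set.ncard_union_eq]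
  · exact (Set.ncard_le_ncard (Set.subset_univ _)).trans (by simp [Set.ncard_univ])
  · rw [Set.disjoint_left]
    rintro j ⟨x, hx, rfl⟩ ⟨y, hy, rfl⟩
    rw [hx] at hy
    exact h (by rw [Option.some.inj hy])

theorem honestCount_le_count {mal : Finset (Fin n)} {recv : Fin n → Option (Fin m → α)}
    {x : Fin n → Fin m → α} (h : ∀ j, j ∉ mal → recv j = some (x j)) (v : α) (c : Fin m) :
    honestCount mal (fun j => x j c) v ≤ count recv v c := by
  classical
  unfold honestCount count
  rw [← Set.ncard_coe_finset]
  refine Set.ncard_le_ncard ?_ (Set.toFinite _)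
  intro j hj
  simp only [Finset.coe_filter, Finset.mem_compl, Set.mem_ofPred_eq] at hj
  exact ⟨x j, h j hj.1, hj.2⟩

theorem count_le_honestCount {mal : Finset (Fin n)} {recv : Fin n → Option (Fin m → α)}
    {x : Fin n → Fin m → α} (h : ∀ j, j ∉ mal → recv j = some (x j)) (v : α) (c : Fin m) :
    count recv v c ≤ honestCount mal (fun j => x j c) v + mal.card := by
  classical
  unfold honestCount count
  refine le_trans ?_ (Finset.card_union_le _ _)
  rw [← Set.ncard_coe_finset]
  refine Set.ncard_le_ncard ?_ (Set.toFinite _)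
  rintro j ⟨w, hw, hv⟩
  by_cases hj : j ∈ mal
  · simp [hj]
  · rw [h j hj] at hw
    simp only [Finset.coe_union, Finset.coe_filter, Finset.mem_compl, Set.mem_union,
      Set.mem_ofPred_eq, Finset.mem_coe]
    left
    exact ⟨hj, by rw [Option.some.inj hw, hv]⟩

theorem honestCount_of_forall {mal : Finset (Fin n)} {x : Fin n → α} {v : α}
    (h : ∀ j, j ∉ mal → x j = v) : honestCount mal x v + mal.card = n := by
  classical
  unfold honestCount
  rw [Finset.filter_true_of_mem (fun j hj => h j (by simpa using hj)), Finset.card_compl,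
    Fintype.card_fin]
  have := Finset.card_le_univ mal
  simp at this
  omega

theorem honestCount_of_forall_ne {mal : Finset (Fin n)} {x : Fin n → α} {v : α}
    (h : ∀ j, j ∉ mal → x j ≠ v) : honestCount mal x v = 0 := by
  classical
  unfold honestCount
  rw [Finset.card_eq_zero, Finset.filter_eq_empty_iff]
  intro j hj
  exact h j (by simpa using hj)

theorem exists_of_honestCount_pos {mal : Finset (Fin n)} {x : Fin n → α} {v : α}
    (h : 0 < honestCount mal x v) : ∃ j, j ∉ mal ∧ x j = v := by
  by_contra! hne
  exact h.ne' (honestCount_of_forall_ne hne)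

theorem honestCount_false_add_true (mal : Finset (Fin n)) (x : Fin n → Bool) :
    honestCount mal x false + honestCount mal x true + mal.card = n := by
  classical
  unfold honestCount
  have h := Finset.card_filter_add_card_filter_not (s := malᶜ) (fun j => x j = false)
  simp only [Bool.not_eq_false] at h
  have h2 : malᶜ.card + mal.card = n := by simp
  refine Eq.trans ?_ h2
  rw [← h]
  congr!

end Counting

section Protocol

variable {n m : ℕ} {V S : Type*} [MeasurableSpace S]
  {mal : Finset (Fin n)} {init : Fin n → Fin m → Option V} {A : Strategy n m V S}
  {ω : S × Oracle n}

/-! ## Graded consensus on unambiguous components -/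

theorem gcRecv1_honest (i : Fin n) {j : Fin n} (hj : j ∉ mal) :
    gcRecv1 mal init A ω i j = some (init j) := by
  simp [gcRecv1, delivered, hj, Msg.toValues]

theorem gcRecv2_honest (i : Fin n) {j : Fin n} (hj : j ∉ mal) :
    gcRecv2 mal init A ω i j = some (gcVec2 mal init A ω j) := by
  simp [gcRecv2, delivered, hj, Msg.toValues]

theorem gcVec2_of_unambiguous (hmal : 3 * mal.card < n) {c : Fin m} {v : Option V}
    (h : ∀ j, j ∉ mal → init j c = v) (i : Fin n) : gcVec2 mal init A ω i c = v := by
  have hlow := honestCount_le_count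
    (fun j => gcRecv1_honest (mal := mal) (init := init) (A := A) (ω := ω) i (j := j)) v c
  have hall := honestCount_of_forall (x := fun j => init j c) h
  have hex : ∃ v : Option V, 2 * n / 3 + 1 ≤ count (gcRecv1 mal init A ω i) v c := ⟨v, by omega⟩
  rw [gcVec2, dif_pos hex]
  -- The value picked by choice is the right one: two values with more than 2n/3 senders each would
  -- need more than n senders.
  by_contra hne
  have h1 := hex.choose_spec
  have h2 := count_add_count_le (gcRecv1 mal init A ω i) c hne
  omega

/-- A common value other than ⊥ reaches grade 2 everywhere, hence bit 0. If the common value is ⊥,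
any other value has malicious support only, so every grade is 0 and every bit is 1. -/
theorem agree_zero_of_unambiguous (hmal : 3 * mal.card < n) {c : Fin m} {v : Option V}
    (h : ∀ j, j ∉ mal → init j c = v) :
    ∃ b : Bool, ∀ i, i ∉ mal → (state mal init A ω 0 i).bits c = b := by
  have hvec : ∀ j, j ∉ mal → gcVec2 mal init A ω j c = v :=
    fun j _ => gcVec2_of_unambiguous hmal h j
  cases v with
  | some x =>
    refine ⟨false, fun i _ => ?_⟩
    have hlow := honestCount_le_count
      (fun j => gcRecv2_honest (mal := mal) (init := init) (A := A) (ω := ω) i (j := j)) (some x) c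
    have hall := honestCount_of_forall (x := fun j => gcVec2 mal init A ω j c) hvec
    have hex : ∃ x : V, 2 * n / 3 + 1 ≤ count (gcRecv2 mal init A ω i) (some x) c :=
      ⟨x, by omega⟩
    simp [state, gcOutput, dif_pos hex]
  | none =>
    refine ⟨true, fun i _ => ?_⟩
    have hup (x : V) : count (gcRecv2 mal init A ω i) (some x) c ≤ mal.card := by
      have := count_le_honestCount
        (fun j => gcRecv2_honest (mal := mal) (init := init) (A := A) (ω := ω) i (j := j)) (some x) c
      rwa [honestCount_of_forall_ne (x := fun j => gcVec2 mal init A ω j c)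
        (fun j hj => by simp [hvec j hj]), zero_add] at this
    have h1 : ¬ ∃ x : V, 2 * n / 3 + 1 ≤ count (gcRecv2 mal init A ω i) (some x) c := by
      rintro ⟨x, hx⟩
      have := hup x
      omega
    have h2 : ¬ ∃ x : V, n / 3 + 1 ≤ count (gcRecv2 mal init A ω i) (some x) c := by
      rintro ⟨x, hx⟩
      have := hup x
      omega
    simp [state, gcOutput, dif_neg h1, dif_neg h2]

/-! ## One step of the binary agreement -/

variable (mal init A ω) in
/-- The messages received by `i` in step `s` of the binary agreement. -/
def received (s : ℕ) (i : Fin n) : Fin n → Option (Msg n m V) :=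
  delivered mal A ω (2 + s) (fun j => honestMsg s j (state mal init A ω s j)) i

theorem state_succ (s : ℕ) (i : Fin n) : state mal init A ω (s + 1) i =
    update ω.2 s (state mal init A ω s i) (received mal init A ω s i) := rfl

theorem received_honest (s : ℕ) (i : Fin n) {j : Fin n} (hj : j ∉ mal) :
    received mal init A ω s i j = honestMsg s j (state mal init A ω s j) := by
  simp [received, delivered, hj]

theorem exits_of_halted (s : ℕ) (i : Fin n) (h : (state mal init A ω s i).halted = true) :
    (state mal init A ω s i).Exits := by
  induction s with
  | zero => simp [state] at h
  | succ s ih =>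
    rw [state_succ] at h ⊢
    unfold update at h ⊢
    split_ifs at h ⊢ with h1 h2
    · exact ih h1
    · exact h2

theorem halted_succ_iff (s : ℕ) (i : Fin n) : (state mal init A ω (s + 1) i).halted = true ↔
    (state mal init A ω s i).Exits := by
  rw [state_succ]
  unfold update
  split_ifs with h1 h2
  · simp [h1, exits_of_halted s i h1]
  · simp [h2]
  · simp [h2]

theorem state_succ_bits_of_exits (s : ℕ) (i : Fin n) (h : (state mal init A ω s i).Exits) :
    (state mal init A ω (s + 1) i).bits = (state mal init A ω s i).bits := by
  rw [state_succ]
  unfold update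
  split_ifs <;> rfl

theorem state_succ_of_fin (s : ℕ) (i : Fin n) (c : Fin m)
    (h : (state mal init A ω s i).fin c = true) :
    (state mal init A ω (s + 1) i).bits c = (state mal init A ω s i).bits c ∧
      (state mal init A ω (s + 1) i).fin c = true := by
  rw [state_succ]
  unfold update
  split_ifs <;> simp [h]

theorem state_succ_of_not_fin (s : ℕ) (i : Fin n) (c : Fin m)
    (h : (state mal init A ω s i).fin c = false) :
    (state mal init A ω (s + 1) i).bits c =
        (newBit ω.2 s (state mal init A ω s i) (received mal init A ω s i) c).1 ∧
      (state mal init A ω (s + 1) i).fin c =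
        (newBit ω.2 s (state mal init A ω s i) (received mal init A ω s i) c).2 := by
  have he : ¬ (state mal init A ω s i).Exits := fun he => by simp [he c] at h
  have hh : ¬ (state mal init A ω s i).halted = true := fun hh => he (exits_of_halted s i hh)
  rw [state_succ]
  unfold update
  rw [if_neg hh, if_neg he]
  simp [h]

theorem not_halted_of_not_fin {s : ℕ} {i : Fin n} {c : Fin m}
    (h : (state mal init A ω s i).fin c = false) : (state mal init A ω s i).halted ≠ true :=
  fun hh => by simp [exits_of_halted s i hh c] at h

/-- An honest sender halts in the step in which its final vector arrives, and its bits are frozen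
from then on. The receiver must still be running, since a halting player no longer records stars. -/
theorem starred_honest (s : ℕ) (i : Fin n) (h : (state mal init A ω s i).halted ≠ true)
    {j : Fin n} (hj : j ∉ mal) : (state mal init A ω s i).starred j =
      if (state mal init A ω s j).halted = true then some (state mal init A ω s j).bits
      else none := by
  induction s with
  | zero => simp [state]
  | succ s ih =>
    rw [Ne, halted_succ_iff] at h
    have hh : (state mal init A ω s i).halted ≠ true := fun hh => h (exits_of_halted s i hh)
    have hst : (state mal init A ω (s + 1) i).starred j =
        match (state mal init A ω s i).starred j, received mal init A ω s i j with
        | some b, _ => some b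
        | none, some (.final b) => some b
        | none, _ => none := by
      exact congrArg (fun p : PlayerState n m => p.starred j) ((if_neg hh).trans (if_neg h))
    rw [hst, ih hh, received_honest s i hj]
    have hiff := halted_succ_iff (mal := mal) (init := init) (A := A) (ω := ω) s j
    by_cases h2 : (state mal init A ω s j).Exits
    · rw [if_pos (hiff.mpr h2), state_succ_bits_of_exits s j h2]
      by_cases h1 : (state mal init A ω s j).halted = true <;> simp [h1, h2, honestMsg]
    · have h1 : ¬ (state mal init A ω s j).halted = true := fun h1 => h2 (exits_of_halted s j h1)
      rw [if_neg (fun h => h2 (hiff.mp h))]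
      by_cases h3 : s % 3 = 2 <;> simp [h1, h2, h3, honestMsg]

/-- Halted honest players keep voting through their recorded final vector, so counts never need to
distinguish running from halted senders. -/
theorem counted_honest (s : ℕ) (i : Fin n) (h : (state mal init A ω s i).halted ≠ true)
    {j : Fin n} (hj : j ∉ mal) :
    counted s (state mal init A ω s i) (received mal init A ω s i) j =
      some (state mal init A ω s j).bits := by
  unfold counted
  rw [starred_honest s i h hj, received_honest s i hj]
  by_cases h1 : (state mal init A ω s j).halted = true
  · simp [h1]
  · by_cases h2 : (state mal init A ω s j).Exits
    · simp [h1, h2, honestMsg]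
    · by_cases h3 : s % 3 = 2 <;> simp [h1, h2, h3, honestMsg]

variable (mal init A ω) in
/-- The number of honest players with bit `b` in component `c` after step `s`. -/
def votes (s : ℕ) (c : Fin m) (b : Bool) : ℕ :=
  honestCount mal (fun j => (state mal init A ω s j).bits c) b

theorem votes_bounds (s : ℕ) (i : Fin n) (h : (state mal init A ω s i).halted ≠ true)
    (c : Fin m) (b : Bool) :
    votes mal init A ω s c b ≤
        count (counted s (state mal init A ω s i) (received mal init A ω s i)) b c ∧
      count (counted s (state mal init A ω s i) (received mal init A ω s i)) b c ≤
        votes mal init A ω s c b + mal.card :=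
  ⟨honestCount_le_count (fun _ hj => counted_honest s i h hj) b c,
    count_le_honestCount (fun _ hj => counted_honest s i h hj) b c⟩

variable (mal init A ω) in
/-- After step `s`, all honest players have the bit `b` in component `c`. -/
def Agree (s : ℕ) (c : Fin m) (b : Bool) : Prop :=
  ∀ i, i ∉ mal → (state mal init A ω s i).bits c = b

/-- The honest votes alone pass the threshold 2n/3 and the malicious ones alone do not, so neither a
default bit nor the common coin is ever used. -/
theorem newBit_of_agree (hmal : 3 * mal.card < n) {s : ℕ} {c : Fin m} {b : Bool}
    (h : Agree mal init A ω s c b) (i : Fin n) (hi : (state mal init A ω s i).halted ≠ true) :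
    newBit ω.2 s (state mal init A ω s i) (received mal init A ω s i) c =
      (b, decide (s % 3 = 0 ∧ b = false ∨ s % 3 = 1 ∧ b = true)) := by
  have h0 := votes_bounds s i hi c false
  have h1 := votes_bounds s i hi c true
  have hv : votes mal init A ω s c b + mal.card = n := honestCount_of_forall h
  have hs := honestCount_false_add_true mal (fun j => (state mal init A ω s j).bits c)
  change votes mal init A ω s c false + votes mal init A ω s c true + _ = _ at hs
  cases b
  · have hp : 2 * n < 3 * count (counted s (state mal init A ω s i)
      (received mal init A ω s i)) false c := by omega
    have hn : ¬ 2 * n < 3 * count (counted s (state mal init A ω s i)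
      (received mal init A ω s i)) true c := by omega
    simp only [newBit, if_pos hp, if_neg hn]
    split_ifs <;> simp_all
  · have hp : 2 * n < 3 * count (counted s (state mal init A ω s i)
      (received mal init A ω s i)) true c := by omega
    have hn : ¬ 2 * n < 3 * count (counted s (state mal init A ω s i)
      (received mal init A ω s i)) false c := by omega
    simp only [newBit, if_pos hp, if_neg hn]
    split_ifs <;> simp_all

theorem Agree.succ (hmal : 3 * mal.card < n) {s : ℕ} {c : Fin m} {b : Bool}
    (h : Agree mal init A ω s c b) : Agree mal init A ω (s + 1) c b := by
  intro i hi
  cases hf : (state mal init A ω s i).fin c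
  · rw [(state_succ_of_not_fin s i c hf).1, newBit_of_agree hmal h i (not_halted_of_not_fin hf)]
  · rw [(state_succ_of_fin s i c hf).1, h i hi]

theorem Agree.mono (hmal : 3 * mal.card < n) {s s' : ℕ} (hs : s ≤ s') {c : Fin m} {b : Bool}
    (h : Agree mal init A ω s c b) : Agree mal init A ω s' c b := by
  induction s', hs using Nat.le_induction with
  | base => exact h
  | succ s' _ ih => exact ih.succ hmal

theorem Agree.fin_succ (hmal : 3 * mal.card < n) {s : ℕ} {c : Fin m} {b : Bool}
    (h : Agree mal init A ω s c b) (hs : s % 3 = 0 ∧ b = false ∨ s % 3 = 1 ∧ b = true)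
    (i : Fin n) : (state mal init A ω (s + 1) i).fin c = true := by
  cases hf : (state mal init A ω s i).fin c
  · rw [(state_succ_of_not_fin s i c hf).2, newBit_of_agree hmal h i (not_halted_of_not_fin hf)]
    simpa using hs
  · exact (state_succ_of_fin s i c hf).2

theorem Agree.fin (hmal : 3 * mal.card < n) {w : ℕ} {c : Fin m} {b : Bool}
    (h : Agree mal init A ω (3 * w) c b) (i : Fin n) :
    (state mal init A ω (3 * w + 2) i).fin c = true := by
  cases b
  · exact (state_succ_of_fin (3 * w + 1) i c
      (h.fin_succ hmal (Or.inl ⟨by omega, rfl⟩) i)).2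
  · exact (h.succ hmal).fin_succ hmal (Or.inr ⟨by omega, rfl⟩) i

/-- Consider the first honest finalization, with bit b. It saw more than 2n/3 votes for b, so the
other bit has fewer than n/3 honest votes and, with all malicious ones added, at most 2n/3. No
honest player adopts the other bit, and the default of that step is b. -/
theorem agree_of_fin (hmal : 3 * mal.card < n) (s : ℕ) (c : Fin m) {i : Fin n} (hi : i ∉ mal)
    (hf : (state mal init A ω s i).fin c = true) : ∃ b, Agree mal init A ω s c b := by
  induction s generalizing i with
  | zero => simp [state] at hf
  | succ s ih =>
    by_cases hex : ∃ j, j ∉ mal ∧ (state mal init A ω s j).fin c = true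
    · obtain ⟨j, hj, hjf⟩ := hex
      obtain ⟨b, hb⟩ := ih hj hjf
      exact ⟨b, hb.succ hmal⟩
    · have hne : ∀ j, j ∉ mal → (state mal init A ω s j).fin c = false := by
        intro j hj
        by_contra hne
        exact hex ⟨j, hj, by simpa using hne⟩
      have hif := hne i hi
      rw [(state_succ_of_not_fin s i c hif).2] at hf
      have hs := honestCount_false_add_true mal (fun j => (state mal init A ω s j).bits c)
      change votes mal init A ω s c false + votes mal init A ω s c true + _ = _ at hs
      have i0 := votes_bounds s i (not_halted_of_not_fin hif) c false
      have i1 := votes_bounds s i (not_halted_of_not_fin hif) c true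
      have key : (s % 3 = 0 ∧ 2 * n < 3 * count (counted s (state mal init A ω s i)
            (received mal init A ω s i)) false c) ∨
          (s % 3 = 1 ∧ 2 * n < 3 * count (counted s (state mal init A ω s i)
            (received mal init A ω s i)) true c) := by
        simp only [newBit] at hf
        split_ifs at hf <;> simp_all
      rcases key with ⟨h3, hc⟩ | ⟨h3, hc⟩
      · refine ⟨false, fun j hj => ?_⟩
        have hjf := hne j hj
        have j1 := votes_bounds s j (not_halted_of_not_fin hjf) c true
        rw [(state_succ_of_not_fin s j c hjf).1]
        have hn : ¬ 2 * n < 3 * count (counted s (state mal init A ω s j)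
          (received mal init A ω s j)) true c := by omega
        simp only [newBit, if_pos h3, if_neg hn]
        split_ifs <;> rfl
      · refine ⟨true, fun j hj => ?_⟩
        have hjf := hne j hj
        have j1 := votes_bounds s j (not_halted_of_not_fin hjf) c false
        rw [(state_succ_of_not_fin s j c hjf).1]
        have hn : ¬ 2 * n < 3 * count (counted s (state mal init A ω s j)
          (received mal init A ω s j)) false c := by omega
        simp only [newBit, if_neg (by omega : ¬ s % 3 = 0), if_pos h3, if_neg hn]
        split_ifs <;> rfl

/-! ## The genuinely flipped coin -/

variable (mal init A ω) in
/-- The value of the common coin in iteration `γ` that makes all honest players agree on the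
component `c`. It is determined before STEP 3. -/
def target (γ : ℕ) (c : Fin m) : Bool :=
  decide (2 * n < 3 * (votes mal init A ω (3 * γ + 2) c true + mal.card))

/-- The player `p` has the strictly smallest value in `r`. -/
def IsStrictMin (r : Fin n → BitString) (p : Fin n) : Prop :=
  ∀ j, j ≠ p → toLex (r p) < toLex (r j)

/-- The values `H (SIG_j (r ‖ γ))` for all counters `γ` and players `j`. -/
def sigRows (H : Oracle n) (γ : ℕ) (j : Fin n) : BitString := H (.ofSig ⟨j, γ⟩)

/-- The values `H (H (SIG_j (r ‖ γ)))` for all counters `γ` and players `j`. -/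
def hashRows (H : Oracle n) (γ : ℕ) (j : Fin n) : BitString := H (.ofHash ⟨j, γ⟩)

theorem IsStrictMin.unique {r : Fin n → BitString} {p q : Fin n} (hp : IsStrictMin r p)
    (hq : IsStrictMin r q) : p = q := by
  by_contra hne
  exact lt_asymm (hp q (Ne.symm hne)) (hq p hne)

/-- Receivers may hold different sets `P`, as malicious signatures can be withheld selectively.
Minimality among all players makes the result independent of `P`. -/
theorem commonCoin_of_isStrictMin {H : Oracle n} {γ : ℕ} {p : Fin n}
    (hp : IsStrictMin (sigRows H γ) p) {P : Set (Fin n)} (hP : p ∈ P) (c : ℕ) :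
    commonCoin H γ P c = hashRows H γ p c := by
  have hmin : ∀ j, sigHash H γ p ≤ sigHash H γ j := by
    intro j
    by_cases hj : j = p
    · rw [hj]
    · exact (hp j hj).le
  classical
  unfold commonCoin
  by_cases hb : H (.ofHash ⟨p, γ⟩) c = true
  · rw [hashRows, hb, decide_eq_true_iff]
    exact ⟨p, hP, fun j _ => hmin j, hb⟩
  · rw [hashRows, Bool.not_eq_true _ |>.mp hb, decide_eq_false_iff_not]
    rintro ⟨q, hq, hqmin, hqb⟩
    by_cases hqp : q = p
    · exact hb (hqp ▸ hqb)
    · exact absurd (hqmin p hP) (not_le.mpr (hp q hqp))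

theorem agree_of_coin (hmal : 3 * mal.card < n) {γ : ℕ} {p : Fin n} (hpm : p ∉ mal)
    (hp : IsStrictMin (sigRows ω.2 γ) p) {c : Fin m}
    (hc : hashRows ω.2 γ p c = target mal init A ω γ c) :
    ∃ b, Agree mal init A ω (3 * γ + 3) c b := by
  by_cases hex : ∃ j, j ∉ mal ∧ (state mal init A ω (3 * γ + 2) j).fin c = true
  · obtain ⟨j, hj, hjf⟩ := hex
    obtain ⟨b, hb⟩ := agree_of_fin hmal _ c hj hjf
    exact ⟨b, hb.succ hmal⟩
  · have hne : ∀ j, j ∉ mal → (state mal init A ω (3 * γ + 2) j).fin c = false := by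
      intro j hj
      by_contra hne
      exact hex ⟨j, hj, by simpa using hne⟩
    refine ⟨target mal init A ω γ c, fun i hi => ?_⟩
    have hif := hne i hi
    have hs := honestCount_false_add_true mal
      (fun j => (state mal init A ω (3 * γ + 2) j).bits c)
    change votes mal init A ω (3 * γ + 2) c false + votes mal init A ω (3 * γ + 2) c true + _ = _
      at hs
    have i0 := votes_bounds (3 * γ + 2) i (not_halted_of_not_fin hif) c false
    have i1 := votes_bounds (3 * γ + 2) i (not_halted_of_not_fin hif) c true
    have hγ : (3 * γ + 2) / 3 = γ := by omega
    -- Since `c` is not finalized, `p` is still running and sends its signature to everyone, rather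
    -- than an unsigned final vector.
    have hmem : p ∈ validSigners (3 * γ + 2) (state mal init A ω (3 * γ + 2) i)
        (received mal init A ω (3 * γ + 2) i) := by
      have hpf := hne p hpm
      have hpe : ¬ (state mal init A ω (3 * γ + 2) p).Exits := fun he => by simp [he c] at hpf
      refine ⟨?_, (state mal init A ω (3 * γ + 2) p).bits, ?_⟩
      · rw [starred_honest _ _ (not_halted_of_not_fin hif) hpm,
          if_neg (not_halted_of_not_fin hpf)]
      · rw [received_honest _ _ hpm]
        unfold honestMsg
        rw [if_neg (not_halted_of_not_fin hpf), if_neg hpe, if_pos (by omega)]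
    rw [(state_succ_of_not_fin _ i c hif).1]
    simp only [newBit]
    rw [if_neg (by omega), if_neg (by omega), hγ]
    -- More than 2n/3 zeros force the target to be 0, more than 2n/3 ones force it to be 1; the coin
    -- decides only in the remaining case.
    split_ifs with h0 h1
    · rw [target, eq_comm, decide_eq_false]
      omega
    · rw [target, eq_comm, decide_eq_true]
      omega
    · rw [← hc]
      exact commonCoin_of_isStrictMin hp hmem c

/-! ## The number of communication steps of a run -/

theorem commSteps_le_of_agree (hmal : 3 * mal.card < n) {w : ℕ}
    (h : ∀ c, ∃ b, Agree mal init A ω (3 * w) c b) :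
    commSteps mal init A ω ≤ ((5 + 3 * w : ℕ) : ℕ∞) := by
  -- Everything is final after 3w + 2 steps of binary agreement; one more step sends the final
  -- vector.
  refine (iInf₂_le (3 * w + 3) fun i _ => ?_).trans (le_of_eq ?_)
  · rw [halted_succ_iff]
    intro c
    obtain ⟨b, hb⟩ := h c
    exact hb.fin hmal i
  · congr 1
    omega

variable (mal init) in
/-- The ambiguous components. -/
def ambiguous : Set (Fin m) := {c | ∃ i j, i ∉ mal ∧ j ∉ mal ∧ init i c ≠ init j c}

theorem commSteps_le_of_coins (hmal : 3 * mal.card < n) {W : ℕ}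
    (h : ∀ c ∈ ambiguous mal init, ∃ γ < W, ∃ p, p ∉ mal ∧ IsStrictMin (sigRows ω.2 γ) p ∧
      hashRows ω.2 γ p c = target mal init A ω γ c) :
    commSteps mal init A ω ≤ ((5 + 3 * W : ℕ) : ℕ∞) := by
  refine commSteps_le_of_agree hmal fun c => ?_
  by_cases hc : c ∈ ambiguous mal init
  · obtain ⟨γ, hγ, p, hpm, hp, hpc⟩ := h c hc
    obtain ⟨b, hb⟩ := agree_of_coin hmal hpm hp hpc
    exact ⟨b, hb.mono hmal (by omega)⟩
  · obtain ⟨i₀, hi₀⟩ : ∃ i, i ∉ mal := by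
      by_contra! hall
      have h1 : mal = Finset.univ := Finset.eq_univ_iff_forall.mpr hall
      rw [h1, Finset.card_univ, Fintype.card_fin] at hmal
      omega
    obtain ⟨b, hb⟩ := agree_zero_of_unambiguous (A := A) (ω := ω) hmal
      (c := c) (v := init i₀ c) (init := init) fun j hj => by
        by_contra hne
        exact hc ⟨j, i₀, hj, hi₀, hne⟩
    exact ⟨b, Agree.mono hmal (Nat.zero_le _) hb⟩

end Protocol

/-! ## Maps all of whose preimages are measurable -/

/-- All preimages under `f` are measurable. -/
def DiscretelyMeasurable {Ω β : Type*} [MeasurableSpace Ω] (f : Ω → β) : Prop :=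
  ∀ B : Set β, MeasurableSet (f ⁻¹' B)

namespace DiscretelyMeasurable

variable {Ω β β' : Type*} [MeasurableSpace Ω]

/-- A preimage under f is a union of fibres of g, hence the preimage under g of its own image; any
image set is admissible. -/
theorem of_factors {f : Ω → β} {g : Ω → β'} (hg : DiscretelyMeasurable g)
    (h : ∀ ω ω', g ω = g ω' → f ω = f ω') : DiscretelyMeasurable f := by
  intro B
  convert hg (g '' (f ⁻¹' B))
  ext ω
  constructor
  · exact fun hω => ⟨ω, hω, rfl⟩
  · rintro ⟨ω', hω', he⟩
    simpa [Set.mem_preimage, h ω' ω he] using hω'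

/-- Arbitrary subsets of a product need not be generated by rectangles; countably many slices remove
the difficulty. -/
theorem prodMk_of_countable_range {f : Ω → β} {g : Ω → β'} (hf : DiscretelyMeasurable f)
    (hg : DiscretelyMeasurable g) (hr : (Set.range g).Countable) :
    DiscretelyMeasurable fun ω => (f ω, g ω) := by
  intro B
  have : (fun ω => (f ω, g ω)) ⁻¹' B =
      ⋃ y ∈ Set.range g, (f ⁻¹' {x | (x, y) ∈ B} ∩ g ⁻¹' {y}) := by
    ext ω
    constructor
    · exact fun h => Set.mem_biUnion (Set.mem_range_self ω) ⟨h, rfl⟩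
    · intro h
      simp only [Set.mem_iUnion] at h
      obtain ⟨y, -, h, rfl⟩ := h
      exact h
  rw [this]
  exact MeasurableSet.biUnion hr fun y _ => (hf _).inter (hg _)

theorem prodMk [Countable β'] {f : Ω → β} {g : Ω → β'} (hf : DiscretelyMeasurable f)
    (hg : DiscretelyMeasurable g) : DiscretelyMeasurable fun ω => (f ω, g ω) :=
  hf.prodMk_of_countable_range hg (Set.to_countable _)

theorem of_singleton [Countable β] {f : Ω → β} (h : ∀ b, MeasurableSet (f ⁻¹' {b})) :
    DiscretelyMeasurable f := by
  intro B
  rw [← Set.biUnion_preimage_singleton]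
  exact MeasurableSet.biUnion B.to_countable fun b _ => h b

theorem pi {ι : Type*} [Finite ι] [Countable β] {f : ι → Ω → β}
    (h : ∀ i, DiscretelyMeasurable (f i)) : DiscretelyMeasurable fun ω i => f i ω := by
  refine of_singleton fun b => ?_
  have : (fun ω i => f i ω) ⁻¹' {b} = ⋂ i, f i ⁻¹' {b i} := by
    ext ω
    simp [funext_iff]
  rw [this]
  exact MeasurableSet.iInter fun i => h i _

theorem measurable [MeasurableSpace β] {f : Ω → β} (hf : DiscretelyMeasurable f) :
    Measurable f := fun B _ => hf B

theorem comp_measurable {Ω' : Type*} [MeasurableSpace Ω'] {f : Ω → β}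
    (hf : DiscretelyMeasurable f) {g : Ω' → Ω} (hg : Measurable g) :
    DiscretelyMeasurable fun ω => f (g ω) := fun B => hg (hf B)

theorem of_bool {f : Ω → Bool} (h : MeasurableSet {ω | f ω = true}) :
    DiscretelyMeasurable f := by
  refine of_singleton fun b => ?_
  cases b
  · convert h.compl using 1
    ext ω
    simp
  · exact h

end DiscretelyMeasurable

theorem measurableSet_toLex_lt {Ω : Type*} [MeasurableSpace Ω] {f g : Ω → BitString}
    (hf : Measurable f) (hg : Measurable g) :
    MeasurableSet {ω | toLex (f ω) < toLex (g ω)} := by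
  have : {ω | toLex (f ω) < toLex (g ω)} =
      ⋃ i : ℕ, (⋂ j : ℕ, ⋂ _ : j < i, {ω | f ω j = g ω j}) ∩ {ω | f ω i < g ω i} := by
    ext ω
    simp only [Set.mem_iUnion, Set.mem_inter_iff, Set.mem_iInter, Set.mem_ofPred_eq]
    -- The lexicographic order is by definition this condition at the first difference.
    exact Iff.rfl
  rw [this]
  have hfi (i : ℕ) : Measurable fun ω => f ω i := (measurable_pi_apply i).comp hf
  have hgi (i : ℕ) : Measurable fun ω => g ω i := (measurable_pi_apply i).comp hg
  refine MeasurableSet.iUnion fun i => MeasurableSet.inter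
    (MeasurableSet.iInter fun j => MeasurableSet.iInter fun _ =>
      measurableSet_eq_fun (hfi j) (hgi j)) ?_
  exact ((hfi i).prodMk (hgi i)) (Set.to_countable {p : Bool × Bool | p.1 < p.2}).measurableSet

theorem measurableSet_toLex_le {Ω : Type*} [MeasurableSpace Ω] {f g : Ω → BitString}
    (hf : Measurable f) (hg : Measurable g) :
    MeasurableSet {ω | toLex (f ω) ≤ toLex (g ω)} := by
  convert (measurableSet_toLex_lt hg hf).compl using 1
  ext ω
  exact (not_lt (a := toLex (g ω)) (b := toLex (f ω))).symm

section Protocol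

variable {n m : ℕ} {V S : Type*} [MeasurableSpace S]
  {mal : Finset (Fin n)} {init : Fin n → Fin m → Option V} {A : Strategy n m V S}

/-! ## What the run depends on -/

theorem known_mono {t t' : ℕ} (ht : t' ≤ t) {H H' : Oracle n}
    (h : known mal t H = known mal t H') : known mal t' H = known mal t' H' := by
  funext q
  have hq := congrFun h q
  cases q with
  | ofSig σ =>
    simp only [known] at hq ⊢
    by_cases hc : σ.signer ∈ mal ∨ 3 * σ.counter + 4 ≤ t'
    · rw [if_pos hc, if_pos hc]
      rwa [if_pos (hc.imp_right fun h => h.trans ht),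
        if_pos (hc.imp_right fun h => h.trans ht)] at hq
    · rw [if_neg hc, if_neg hc]
  | ofHash σ =>
    simp only [known] at hq ⊢
    by_cases hc : σ.signer ∈ mal ∨ 3 * σ.counter + 4 ≤ t'
    · rw [if_pos hc, if_pos hc]
      rwa [if_pos (hc.imp_right fun h => h.trans ht),
        if_pos (hc.imp_right fun h => h.trans ht)] at hq
    · rw [if_neg hc, if_neg hc]

theorem commonCoin_eq_true_iff {H : Oracle n} {γ : ℕ} {P : Set (Fin n)} {c : ℕ} :
    commonCoin H γ P c = true ↔
      ∃ p ∈ P, (∀ j ∈ P, sigHash H γ p ≤ sigHash H γ j) ∧ H (.ofHash ⟨p, γ⟩) c = true := by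
  classical
  unfold commonCoin
  exact decide_eq_true_iff

theorem commonCoin_congr {t γ : ℕ} (ht : 3 * γ + 4 ≤ t) {H H' : Oracle n}
    (h : known mal t H = known mal t H') : commonCoin H γ = commonCoin H' γ := by
  have h1 (j : Fin n) : H (.ofSig ⟨j, γ⟩) = H' (.ofSig ⟨j, γ⟩) := by
    simpa [known, ht] using congrFun h (.ofSig ⟨j, γ⟩)
  have h2 (j : Fin n) : H (.ofHash ⟨j, γ⟩) = H' (.ofHash ⟨j, γ⟩) := by
    simpa [known, ht] using congrFun h (.ofHash ⟨j, γ⟩)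
  funext P c
  rw [Bool.eq_iff_iff, commonCoin_eq_true_iff, commonCoin_eq_true_iff]
  simp only [sigHash, h1, h2]

theorem delivered_congr {ω ω' : S × Oracle n} {t : ℕ}
    (h : A.act t (ω.1, known mal t ω.2) = A.act t (ω'.1, known mal t ω'.2)) :
    delivered mal A ω t = delivered mal A ω' t := by
  funext own i j
  simp only [delivered, h]

theorem gcVec2_congr {ω ω' : S × Oracle n}
    (h : A.act 0 (ω.1, known mal 0 ω.2) = A.act 0 (ω'.1, known mal 0 ω'.2)) :
    gcVec2 mal init A ω = gcVec2 mal init A ω' := by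
  funext i c
  have h1 : gcRecv1 mal init A ω = gcRecv1 mal init A ω' := by
    funext i j
    simp only [gcRecv1, delivered_congr h]
  unfold gcVec2
  rw [h1]

theorem state_zero_congr {ω ω' : S × Oracle n}
    (h0 : gcVec2 mal init A ω = gcVec2 mal init A ω')
    (h1 : A.act 1 (ω.1, known mal 1 ω.2) = A.act 1 (ω'.1, known mal 1 ω'.2)) :
    state mal init A ω 0 = state mal init A ω' 0 := by
  have h2 : gcRecv2 mal init A ω = gcRecv2 mal init A ω' := by
    funext i j
    simp only [gcRecv2, delivered_congr h1, h0]
  funext i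
  simp only [state]
  unfold gcOutput
  rw [h2]

theorem state_succ_congr {ω ω' : S × Oracle n} {s : ℕ}
    (h0 : state mal init A ω s = state mal init A ω' s)
    (h1 : A.act (2 + s) (ω.1, known mal (2 + s) ω.2) =
      A.act (2 + s) (ω'.1, known mal (2 + s) ω'.2))
    (h2 : s % 3 = 2 → ∀ P, ∀ c : Fin m, commonCoin ω.2 (s / 3) P c = commonCoin ω'.2 (s / 3) P c) :
    state mal init A ω (s + 1) = state mal init A ω' (s + 1) := by
  funext i
  have hr : received mal init A ω s = received mal init A ω' s := by
    funext i
    simp only [received, delivered_congr h1, h0]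
  have hb : (newBit ω.2 s : PlayerState n m → (Fin n → Option (Msg n m V)) → _) =
      newBit ω'.2 s := by
    funext p msg c
    simp only [newBit]
    by_cases h3 : s % 3 = 2
    · simp only [h2 h3]
    · split_ifs <;> first | rfl | omega
  rw [state_succ, state_succ, hr, h0]
  unfold update
  rw [hb]

/-- The last round that influences the state after s steps is round s + 1. -/
theorem state_congr {ω ω' : S × Oracle n} {s : ℕ} (h1 : ω.1 = ω'.1)
    (h2 : known mal (s + 1) ω.2 = known mal (s + 1) ω'.2) :
    state mal init A ω s = state mal init A ω' s := by
  induction s with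
  | zero =>
    refine state_zero_congr (gcVec2_congr ?_) (by rw [h1, h2])
    rw [h1, known_mono zero_le_one h2]
  | succ s ih =>
    have h2' : known mal (2 + s) ω.2 = known mal (2 + s) ω'.2 := by
      rwa [show 2 + s = s + 1 + 1 by omega]
    refine state_succ_congr (ih (known_mono (by omega) h2)) (by rw [h1, h2']) fun h3 P c => ?_
    rw [commonCoin_congr (by omega) h2]

/-- Round 3γ + 3 is the last one before STEP 3 of iteration γ, so the honest hashes of that
iteration cannot affect its target. -/
theorem target_congr {ω ω' : S × Oracle n} {γ : ℕ} (h1 : ω.1 = ω'.1)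
    (h2 : known mal (3 * γ + 3) ω.2 = known mal (3 * γ + 3) ω'.2) :
    target mal init A ω γ = target mal init A ω' γ := by
  funext c
  unfold target votes
  rw [state_congr h1 h2]

/-! ## Measurability of the run -/

theorem measurable_known (t : ℕ) : Measurable (known mal t : Oracle n → Oracle n) := by
  refine measurable_pi_iff.mpr fun q => ?_
  cases q with
  | ofSig σ =>
    simp only [known]
    split_ifs
    · exact measurable_pi_apply _
    · exact measurable_const
  | ofHash σ =>
    simp only [known]
    split_ifs
    · exact measurable_pi_apply _
    · exact measurable_const

theorem discretelyMeasurable_act (t : ℕ) :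
    DiscretelyMeasurable fun ω : S × Oracle n => A.act t (ω.1, known mal t ω.2) :=
  DiscretelyMeasurable.comp_measurable (f := A.act t) (A.measurable_act t)
    (measurable_fst.prodMk ((measurable_known t).comp measurable_snd))

/-- `V` may be uncountable, but a value with more than 2n/3 senders is the initial value of some
honest player, and only finitely many such values exist. -/
theorem finite_range_gcVec2 (hmal : 3 * mal.card < n) :
    (Set.range fun ω : S × Oracle n => gcVec2 mal init A ω).Finite := by
  have hF : {f : Fin n → Fin m → Option V |
      ∀ i, f i ∈ {g : Fin m → Option V |
        ∀ c, g c ∈ insert none (Set.range fun j => init j c)}}.Finite :=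
    Set.Finite.pi' fun _ => Set.Finite.pi' fun c => (Set.finite_range _).insert _
  refine hF.subset ?_
  rintro _ ⟨ω, rfl⟩ i c
  simp only [gcVec2]
  split_ifs with hex
  · have hup := count_le_honestCount
      (fun j => gcRecv1_honest (mal := mal) (init := init) (A := A) (ω := ω) i (j := j))
      hex.choose c
    obtain ⟨j, -, hj⟩ := exists_of_honestCount_pos (mal := mal) (x := fun j => init j c)
      (v := hex.choose) (by have := hex.choose_spec; omega)
    exact Set.mem_insert_of_mem _ ⟨j, hj⟩
  · exact Set.mem_insert _ _

instance : Finite (PlayerState n m) :=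
  Finite.of_injective (fun p : PlayerState n m => (p.bits, p.fin, p.halted, p.starred)) (by
    rintro ⟨⟩ ⟨⟩ h
    simp only [Prod.mk.injEq] at h
    obtain ⟨rfl, rfl, rfl, rfl⟩ := h
    rfl)

theorem discretelyMeasurable_commonCoin (γ : ℕ) :
    DiscretelyMeasurable fun (H : Oracle n) (P : Set (Fin n)) (c : Fin m) =>
      commonCoin H γ P c := by
  refine .pi fun P => .pi fun c => .of_bool ?_
  have : {H : Oracle n | commonCoin H γ P c = true} =
      ⋃ p ∈ P, (⋂ j ∈ P, {H | sigHash H γ p ≤ sigHash H γ j}) ∩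
        {H | H (.ofHash ⟨p, γ⟩) c = true} := by
    ext H
    simp [commonCoin_eq_true_iff, and_left_comm]
  rw [this]
  refine MeasurableSet.biUnion P.to_countable fun p _ => MeasurableSet.inter
    (MeasurableSet.biInter P.to_countable fun j _ =>
      measurableSet_toLex_le (measurable_pi_apply _) (measurable_pi_apply _)) ?_
  exact measurableSet_eq_fun ((measurable_pi_apply (c : ℕ)).comp
    (measurable_pi_apply (Query.ofHash ⟨p, γ⟩))) measurable_const

theorem discretelyMeasurable_state (hmal : 3 * mal.card < n) (s : ℕ) :
    DiscretelyMeasurable fun ω : S × Oracle n => state mal init A ω s := by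
  induction s with
  | zero =>
    have h0 : DiscretelyMeasurable fun ω : S × Oracle n => gcVec2 mal init A ω :=
      (discretelyMeasurable_act (mal := mal) (A := A) 0).of_factors fun _ _ h => gcVec2_congr h
    refine ((discretelyMeasurable_act (mal := mal) (A := A) 1).prodMk_of_countable_range h0
      (finite_range_gcVec2 hmal).countable).of_factors fun ω ω' h => ?_
    rw [Prod.mk.injEq] at h
    exact state_zero_congr h.2 h.1
  | succ s ih =>
    refine (((discretelyMeasurable_act (mal := mal) (A := A) (2 + s)).prodMk ih).prodMk
      ((discretelyMeasurable_commonCoin (m := m) (s / 3)).comp_measurable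
        measurable_snd)).of_factors fun ω ω' h => ?_
    rw [Prod.mk.injEq, Prod.mk.injEq] at h
    exact state_succ_congr h.1.2 h.1.1 fun _ P c => congrFun (congrFun h.2 P) c

theorem measurable_target (hmal : 3 * mal.card < n) (γ : ℕ) (c : Fin m) :
    Measurable fun ω : S × Oracle n => target mal init A ω γ c :=
  ((discretelyMeasurable_state (init := init) (A := A) hmal (3 * γ + 2)).of_factors fun ω ω' h => by
    unfold target votes
    rw [h]).measurable

end Protocol

/-! ## Product measures -/

section ProductMeasure

open Measure

variable {ι X : Type*} [MeasurableSpace X]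

-- The two copies are read on complementary index sets, so a box pulls back to a product of boxes.
-- This is what permits redrawing part of the oracle.
open Classical in
theorem measurePreserving_piecewise_infinitePi (μ : ι → Measure X)
    [∀ i, IsProbabilityMeasure (μ i)] (D : Set ι) :
    MeasurePreserving (fun p : (ι → X) × (ι → X) => fun i => if i ∈ D then p.2 i else p.1 i)
      ((infinitePi μ).prod (infinitePi μ)) (infinitePi μ) := by
  have hm : Measurable
      fun p : (ι → X) × (ι → X) => fun i => if i ∈ D then p.2 i else p.1 i := by
    refine measurable_pi_iff.mpr fun i => ?_
    split_ifs <;> fun_prop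
  refine ⟨hm, eq_infinitePi _ fun s t ht => ?_⟩
  rw [map_apply hm (.pi s.countable_toSet fun i _ => ht i)]
  have : (fun p : (ι → X) × (ι → X) => fun i => if i ∈ D then p.2 i else p.1 i) ⁻¹'
      (Set.pi s t) = (Set.pi ↑(s.filter fun i => ¬ i ∈ D) t) ×ˢ
        (Set.pi ↑(s.filter fun i => i ∈ D) t) := by
    ext p
    simp only [Set.mem_preimage, Set.mem_pi, Finset.mem_coe, Set.mem_prod, Finset.mem_filter]
    constructor
    · exact fun h => ⟨fun i hi => by simpa [hi.2] using h i hi.1,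
        fun i hi => by simpa [hi.2] using h i hi.1⟩
    · intro h i hi
      split_ifs with hD
      · exact h.2 i ⟨hi, hD⟩
      · exact h.1 i ⟨hi, hD⟩
  rw [this, prod_prod, infinitePi_pi _ fun i _ => ht i, infinitePi_pi _ fun i _ => ht i, mul_comm,
    Finset.prod_filter_mul_prod_filter_not]

theorem measurePreserving_update_infinitePi [DecidableEq ι] (μ : ι → Measure X)
    [∀ i, IsProbabilityMeasure (μ i)] (k : ι) :
    MeasurePreserving (fun p : (ι → X) × X => Function.update p.1 k p.2)
      ((infinitePi μ).prod (μ k)) (infinitePi μ) := by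
  have hm : Measurable fun p : (ι → X) × X => Function.update p.1 k p.2 := by
    refine measurable_pi_iff.mpr fun i => ?_
    by_cases hi : i = k
    · subst hi
      simpa using measurable_snd
    · simp only [Function.update_of_ne hi]
      fun_prop
  refine ⟨hm, eq_infinitePi _ fun s t ht => ?_⟩
  rw [map_apply hm (.pi s.countable_toSet fun i _ => ht i)]
  by_cases hk : k ∈ s
  · have : (fun p : (ι → X) × X => Function.update p.1 k p.2) ⁻¹' (Set.pi s t) =
        (Set.pi ↑(s.erase k) t) ×ˢ t k := by
      ext p
      simp only [Set.mem_preimage, Set.mem_pi, Finset.mem_coe, Set.mem_prod, Finset.mem_erase]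
      constructor
      · exact fun h => ⟨fun i hi => by simpa [hi.1] using h i hi.2, by simpa using h k hk⟩
      · intro h i hi
        by_cases hik : i = k
        · subst hik
          simpa using h.2
        · simpa [hik] using h.1 i ⟨hik, hi⟩
    rw [this, prod_prod, infinitePi_pi _ fun i _ => ht i, Finset.prod_erase_mul _ _ hk]
  · have : (fun p : (ι → X) × X => Function.update p.1 k p.2) ⁻¹' (Set.pi s t) =
        (Set.pi s t) ×ˢ Set.univ := by
      ext p
      simp only [Set.mem_preimage, Set.mem_pi, Finset.mem_coe, Set.mem_prod, Set.mem_univ,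
        and_true]
      refine forall₂_congr fun i hi => ?_
      have hik : i ≠ k := fun h => hk (h ▸ hi)
      simp [hik]
    rw [this, prod_prod, infinitePi_pi _ fun i _ => ht i, measure_univ, mul_one]

/-- A sequence of independent variables with law `ρ` remains a sequence of independent variables
when each term is transformed by a map that depends on the earlier terms and always sends `ρ`
to `σ`. -/
theorem measurePreserving_predictable {Z Y : Type*} [MeasurableSpace Z] [MeasurableSpace Y]
    (ρ : Measure Z) (σ : Measure Y) [IsProbabilityMeasure ρ] [IsProbabilityMeasure σ]
    (f : ℕ → (ℕ → Z) → Z → Y) (hf : ∀ k, Measurable (Function.uncurry (f k)))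
    (hdep : ∀ k z z', (∀ i < k, z i = z' i) → f k z = f k z')
    (hlaw : ∀ k z, ρ.map (f k z) = σ) :
    MeasurePreserving (fun z k => f k z (z k)) (infinitePi fun _ : ℕ => ρ)
      (infinitePi fun _ : ℕ => σ) := by
  have hfk (k : ℕ) : Measurable fun z : ℕ → Z => f k z (z k) :=
    (hf k).comp (measurable_id.prodMk (measurable_pi_apply k))
  have hm : Measurable fun (z : ℕ → Z) k => f k z (z k) := measurable_pi_iff.mpr hfk
  have key (t : ℕ → Set Y) (ht : ∀ i, MeasurableSet (t i)) (N : ℕ) :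
      (infinitePi fun _ : ℕ => ρ) {z | ∀ i < N, f i z (z i) ∈ t i} =
        ∏ i ∈ Finset.range N, σ (t i) := by
    induction N with
    | zero => simp
    | succ N ih =>
      have hA : MeasurableSet {z : ℕ → Z | ∀ i < N, f i z (z i) ∈ t i} := by
        simp only [Set.ofPred_forall]
        exact MeasurableSet.iInter fun i => MeasurableSet.iInter fun _ => hfk i (ht i)
      have hA' : MeasurableSet {z : ℕ → Z | ∀ i < N + 1, f i z (z i) ∈ t i} := by
        simp only [Set.ofPred_forall]
        exact MeasurableSet.iInter fun i => MeasurableSet.iInter fun _ => hfk i (ht i)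
      have hup := measurePreserving_update_infinitePi (fun _ : ℕ => ρ) N
      -- Coordinate `N` is redrawn independently. The conditions with i < N do not see it, and for
      -- fixed `z` the last condition has probability `σ (t N)`.
      rw [← hup.measure_preimage hA'.nullMeasurableSet, prod_apply (hup.measurable hA'),
        Finset.prod_range_succ, ← ih, ← lintegral_indicator_one hA, ← lintegral_mul_const _
          (measurable_one.indicator hA)]
      refine lintegral_congr fun z => ?_
      have hz (x : Z) (i : ℕ) (hi : i ≤ N) : f i (Function.update z N x) = f i z :=
        hdep i _ _ fun j hj => Function.update_of_ne (by omega) _ _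
      by_cases hzA : ∀ i < N, f i z (z i) ∈ t i
      · rw [Set.indicator_of_mem (by exact hzA), Pi.one_apply, one_mul, ← hlaw N z,
          map_apply (f := f N z) ((hf N).comp measurable_prodMk_left) (ht N)]
        congr 1
        ext x
        simp only [Set.mem_preimage, Set.mem_ofPred_eq]
        constructor
        · intro h
          simpa [hz x N le_rfl] using h N (by omega)
        · intro h i hi
          rw [hz x i (by omega)]
          rcases Nat.lt_succ_iff_lt_or_eq.mp hi with hi | rfl
          · rw [Function.update_of_ne (by omega)]
            exact hzA i hi
          · simpa using h
      · rw [Set.indicator_of_notMem (by exact hzA), zero_mul]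
        convert measure_empty (μ := ρ)
        ext x
        simp only [Set.mem_preimage, Set.mem_ofPred_eq, Set.mem_empty_iff_false, iff_false]
        refine fun h => hzA fun i hi => ?_
        have := h i (by omega)
        rwa [hz x i hi.le, Function.update_of_ne (by omega)] at this
  refine ⟨hm, eq_infinitePi _ fun s t ht => ?_⟩
  classical
  rw [map_apply hm (.pi s.countable_toSet fun i _ => ht i)]
  obtain ⟨N, hN⟩ : ∃ N, s ⊆ Finset.range N := s.exists_nat_subset_range
  -- Trivial conditions enlarge the index set to an initial segment.
  have h1 := key (fun i => if i ∈ s then t i else Set.univ)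
    (fun i => by split_ifs <;> simp [ht]) N
  rw [← Finset.prod_subset hN (fun i _ hi => by simp [hi])] at h1
  rw [Finset.prod_congr rfl (fun i hi => by rw [if_pos hi])] at h1
  rw [← h1]
  congr 1
  ext z
  simp only [Set.mem_preimage, Set.mem_pi, Finset.mem_coe, Set.mem_ofPred_eq]
  constructor
  · intro h i _
    split_ifs with hi
    · exact h i hi
    · trivial
  · intro h i hi
    simpa [hi] using h i (Finset.mem_range.mp (hN hi))

theorem measurePreserving_rows {κ : Type*} {θ : Type*} (μ : Measure X) [IsProbabilityMeasure μ]
    {e : κ → θ → ι} (he : Function.Injective (Function.uncurry e)) :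
    MeasurePreserving (fun (x : ι → X) k j => x (e k j)) (infinitePi fun _ : ι => μ)
      (infinitePi fun _ : κ => infinitePi fun _ : θ => μ) := by
  refine ⟨by fun_prop, ?_⟩
  rw [← infinitePi_map_curry (fun (_ : κ) (_ : θ) => μ),
    ← map_infinitePi_infinitePi_of_inj (P := fun _ : ι => μ) he, map_map (by fun_prop) (by fun_prop)]
  rfl

theorem measurePreserving_swap {κ θ : Type*} (μ : Measure X) [IsProbabilityMeasure μ] :
    MeasurePreserving (fun (x : κ → θ → X) j k => x k j)
      (infinitePi fun _ : κ => infinitePi fun _ : θ => μ)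
      (infinitePi fun _ : θ => infinitePi fun _ : κ => μ) := by
  refine ⟨by fun_prop, ?_⟩
  rw [← infinitePi_map_curry (fun (_ : κ) (_ : θ) => μ), map_map (by fun_prop) (by fun_prop)]
  exact (measurePreserving_rows (κ := θ) (θ := κ) (ι := κ × θ) μ
    (e := fun j k => (k, j)) (by rintro ⟨a, b⟩ ⟨c, d⟩ h; simp_all [Function.uncurry])).map_eq

/-- Among independent bits arranged in a matrix, the probability that each of the columns in `C`
contains the value `v` in one of the rows in `G`. -/
theorem infinitePi_columns {κ θ : Type*} (β : Measure Bool) [IsProbabilityMeasure β]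
    (G : Finset κ) (C : Finset θ) (v : Bool) :
    (infinitePi fun _ : κ => infinitePi fun _ : θ => β)
        {x | ∀ c ∈ C, ∃ k ∈ G, x k c = v} = (1 - β {!v} ^ G.card) ^ C.card := by
  have hB : MeasurableSet (Set.pi G fun _ : κ => ({!v} : Set Bool)) :=
    .pi G.countable_toSet fun _ _ => measurableSet_singleton _
  have hC : MeasurableSet (Set.pi C fun _ : θ => (Set.pi G fun _ : κ => ({!v} : Set Bool))ᶜ) :=
    .pi C.countable_toSet fun _ _ => hB.compl
  have : {x : κ → θ → Bool | ∀ c ∈ C, ∃ k ∈ G, x k c = v} = (fun (x : κ → θ → Bool) j k => x k j)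
      ⁻¹' (Set.pi C fun _ : θ => (Set.pi G fun _ : κ => ({!v} : Set Bool))ᶜ) := by
    ext x
    simp [Set.mem_pi]
  -- After transposition the columns are independent, and a column fails exactly on a box.
  rw [this, (measurePreserving_swap β).measure_preimage hC.nullMeasurableSet,
    infinitePi_pi _ fun _ _ => hB.compl, Finset.prod_const, prob_compl_eq_one_sub hB,
    infinitePi_pi _ fun _ _ => measurableSet_singleton _, Finset.prod_const]

end ProductMeasure

/-! ## The coin game -/

theorem mem_remaining {l : ℕ} (x : Flips l) (w : ℕ) (c : Fin l) :
    c ∈ remaining x w ↔ ∀ k < w, x k c = false := by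
  induction w with
  | zero => simp [remaining]
  | succ w ih =>
    rw [remaining, Finset.mem_filter, ih]
    constructor
    · rintro ⟨h1, h2⟩ k hk
      rcases Nat.lt_succ_iff_lt_or_eq.mp hk with hk | rfl
      · exact h1 k hk
      · exact h2
    · exact fun h => ⟨fun k hk => h k (by omega), h w (by omega)⟩

theorem chi_le_iff {l : ℕ} (x : Flips l) (W : ℕ) :
    chi x ≤ W ↔ ∀ c, ∃ k < W, x k c = true := by
  have hiff : (∀ c, ∃ k < W, x k c = true) ↔ remaining x W = ∅ := by
    simp only [Finset.eq_empty_iff_forall_notMem, mem_remaining]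
    push Not
    simp
  constructor
  · intro h
    -- A strict inequality is needed to extract a witness from the infimum.
    have : chi x < ((W + 1 : ℕ) : ℕ∞) := h.trans_lt (by exact_mod_cast Nat.lt_succ_self W)
    simp only [chi, iInf_lt_iff] at this
    obtain ⟨w, hw, hlt⟩ := this
    have hwW : w ≤ W := by
      have : w < W + 1 := by exact_mod_cast hlt
      omega
    intro c
    have hc : c ∉ remaining x w := by simp [hw]
    rw [mem_remaining] at hc
    push Not at hc
    obtain ⟨k, hk, hxk⟩ := hc
    exact ⟨k, by omega, by simpa using hxk⟩
  · intro h
    exact iInf₂_le W (hiff.mp h)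

theorem flipLaw_chi_le (l : ℕ) (p : unitInterval) (W : ℕ) :
    flipLaw l p {x | chi x ≤ W} = ENNReal.ofReal ((1 - (1 - (p : ℝ)) ^ W) ^ l) := by
  have h := infinitePi_columns (bernoulliMeasure true false p) (Finset.range W)
    (Finset.univ : Finset (Fin l)) true
  have hset : {x : Flips l | chi x ≤ W} =
      {x | ∀ c ∈ (Finset.univ : Finset (Fin l)), ∃ k ∈ Finset.range W, x k c = true} := by
    ext x
    simp [chi_le_iff]
  have hb : bernoulliMeasure true false p {!true} = ENNReal.ofReal (1 - (p : ℝ)) := by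
    rw [bernoulliMeasure_apply_of_notMem_of_mem p (measurableSet_singleton _) (by simp) (by simp)]
    rw [ENNReal.ofReal, ← unitInterval.coe_symm_eq]
    congr 1
    ext
    simp [p.2.2]
  have hp0 : 0 ≤ 1 - (p : ℝ) := by linarith [p.2.2]
  have hp1 : 1 - (p : ℝ) ≤ 1 := by linarith [p.2.1]
  rw [flipLaw, hset]
  simp only [Measure.infinitePi_eq_pi] at h
  rw [h, hb, ← ENNReal.ofReal_pow hp0, ← ENNReal.ofReal_one,
    ← ENNReal.ofReal_sub _ (by positivity), ← ENNReal.ofReal_pow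
      (sub_nonneg.mpr (pow_le_one₀ hp0 hp1))]
  simp

/-! ## Uniform bit strings -/

/-- The law of a fair bit. -/
abbrev fairBit : Measure Bool := (PMF.uniformOfFintype Bool).toMeasure

theorem fairBit_singleton (b : Bool) : fairBit {b} = 2⁻¹ := by
  rw [PMF.toMeasure_apply_singleton _ _ (measurableSet_singleton b)]
  simp

instance : IsProbabilityMeasure uniformBits := by unfold uniformBits; infer_instance

instance (n : ℕ) : IsProbabilityMeasure (oracleLaw n) := by unfold oracleLaw; infer_instance

theorem map_xor_fairBit (b : Bool) : fairBit.map (fun x => xor x b) = fairBit := by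
  have h (x : Bool) : fairBit.map (fun x => xor x b) {x} = 2⁻¹ := by
    rw [Measure.map_apply .of_discrete (measurableSet_singleton _)]
    convert fairBit_singleton (xor x b)
    ext y
    cases x <;> cases y <;> cases b <;> simp
  exact Measure.ext_of_singleton fun x => by rw [h, fairBit_singleton]

/-- Applied with the adversary's target as the mask: comparing fair bits with a fixed target leaves
them fair and independent. -/
theorem map_xor_uniformBits (mask : BitString) :
    uniformBits.map (fun x c => xor (x c) (mask c)) = uniformBits := by
  rw [uniformBits, Measure.infinitePi_map_pi (f := fun c x => xor x (mask c)) _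
    fun c => .of_discrete]
  simp only [map_xor_fairBit]

instance : NullSingletonClass uniformBits := by
  refine ⟨fun x => ?_⟩
  have h (k : ℕ) : uniformBits {x} ≤ (2⁻¹ : ENNReal) ^ k := by
    calc uniformBits {x} ≤ uniformBits (Set.pi (Finset.range k) fun c => {x c}) :=
          measure_mono (by rintro y rfl; simp [Set.mem_pi])
      _ = (2⁻¹ : ENNReal) ^ k := by
          rw [uniformBits, Measure.infinitePi_pi _ fun c _ => measurableSet_singleton _]
          simp only [fairBit_singleton, Finset.prod_const, Finset.card_range]
  have h0 : Filter.Tendsto (fun k : ℕ => (2⁻¹ : ENNReal) ^ k) Filter.atTop (nhds 0) :=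
    ENNReal.tendsto_pow_atTop_nhds_zero_of_lt_one (by simp)
  exact le_antisymm (ge_of_tendsto' h0 h) bot_le

/-! ## The player with the smallest value -/

/-- The law of one independent uniform bit string for each player. -/
def rowLaw (n : ℕ) : Measure (Fin n → BitString) := Measure.infinitePi fun _ => uniformBits

instance (n : ℕ) : IsProbabilityMeasure (rowLaw n) := by unfold rowLaw; infer_instance

section

variable {n : ℕ}

theorem measurableSet_isStrictMin (p : Fin n) : MeasurableSet {r | IsStrictMin r p} := by
  simp only [IsStrictMin, Set.ofPred_forall]
  exact MeasurableSet.iInter fun j => MeasurableSet.iInter fun _ =>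
    measurableSet_toLex_lt (measurable_pi_apply _) (measurable_pi_apply _)

theorem rowLaw_tie {i j : Fin n} (hij : i ≠ j) : rowLaw n {r | r i = r j} = 0 := by
  have hm : Measurable fun r : Fin n → BitString => (r i, r j) := by fun_prop
  have hd : MeasurableSet (Set.diagonal BitString) := measurableSet_diagonal
  have : {r : Fin n → BitString | r i = r j} = (fun r => (r i, r j)) ⁻¹' Set.diagonal BitString :=
    rfl
  rw [this, ← Measure.map_apply hm hd, rowLaw, Measure.infinitePi_map_eval_prod hij,
    Measure.prod_apply hd]
  have h (x : BitString) : Prod.mk x ⁻¹' Set.diagonal BitString = {x} := by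
    ext y
    simp [eq_comm]
  simp [h]

theorem rowLaw_isStrictMin_eq (p q : Fin n) :
    rowLaw n {r | IsStrictMin r p} = rowLaw n {r | IsStrictMin r q} := by
  have hmp : MeasurePreserving (fun (r : Fin n → BitString) i => r (Equiv.swap p q i))
      (rowLaw n) (rowLaw n) :=
    ⟨by fun_prop, Measure.map_infinitePi_infinitePi_of_inj (P := fun _ => uniformBits)
      (Equiv.swap p q).injective⟩
  rw [← hmp.measure_preimage (measurableSet_isStrictMin p).nullMeasurableSet]
  congr 1
  ext r
  simp only [Set.mem_preimage, Set.mem_ofPred_eq, IsStrictMin, Equiv.swap_apply_left]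
  constructor
  · intro h j hj
    have := h (Equiv.swap p q j) (fun he => hj (by
      rw [← Equiv.swap_apply_self p q j, he, Equiv.swap_apply_left]))
    rwa [Equiv.swap_apply_self] at this
  · intro h j hj
    exact h _ (fun he => hj (by
      rw [← Equiv.swap_apply_self p q j, he, Equiv.swap_apply_right]))

theorem rowLaw_exists_isStrictMin (hn : 0 < n) : rowLaw n {r | ∃ p, IsStrictMin r p} = 1 := by
  have hsub : {r : Fin n → BitString | ∃ p, IsStrictMin r p}ᶜ ⊆
      ⋃ i : Fin n, ⋃ j : Fin n, ⋃ _ : i ≠ j, {r | r i = r j} := by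
    intro r hr
    have : Nonempty (Fin n) := ⟨⟨0, hn⟩⟩
    obtain ⟨p, hp⟩ := Finite.exists_min fun i => toLex (r i)
    have hp' : ¬ IsStrictMin r p := fun h => hr ⟨p, h⟩
    simp only [IsStrictMin, not_forall] at hp'
    obtain ⟨j, hj, hlt⟩ := hp'
    have he : toLex (r p) = toLex (r j) := (eq_or_lt_of_le (hp j)).resolve_right hlt
    simp only [Set.mem_iUnion]
    exact ⟨p, j, Ne.symm hj, toLex_inj.mp he⟩
  have hm : MeasurableSet {r : Fin n → BitString | ∃ p, IsStrictMin r p} := by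
    simp only [Set.ofPred_exists]
    exact MeasurableSet.iUnion measurableSet_isStrictMin
  rw [← prob_compl_eq_zero_iff hm]
  refine measure_mono_null hsub ?_
  simp only [measure_iUnion_null_iff]
  exact fun i j hij => rowLaw_tie hij

/-- The events of different players are disjoint, equally likely by exchangeability, and exhaust the
space up to ties, which are null. -/
theorem rowLaw_isStrictMin_mem (hn : 0 < n) (J : Finset (Fin n)) :
    (rowLaw n).real {r | ∃ p ∈ J, IsStrictMin r p} = (J.card : ℝ) / n := by
  have hsum (J : Finset (Fin n)) (q : Fin n) : (rowLaw n).real {r | ∃ p ∈ J, IsStrictMin r p} =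
      J.card * (rowLaw n).real {r | IsStrictMin r q} := by
    have : {r : Fin n → BitString | ∃ p ∈ J, IsStrictMin r p} =
        ⋃ p ∈ J, {r | IsStrictMin r p} := by
      ext r
      simp
    rw [this, measureReal_biUnion_finset]
    · simp [measureReal_def, rowLaw_isStrictMin_eq _ q]
    · intro p _ p' _ hne
      exact Set.disjoint_left.mpr fun r h h' => hne (h.unique h')
    · exact fun p _ => measurableSet_isStrictMin p
  have h1 := hsum Finset.univ ⟨0, hn⟩
  have h2 : (rowLaw n).real {r | ∃ p ∈ Finset.univ, IsStrictMin r p} = 1 := by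
    simp [measureReal_def, rowLaw_exists_isStrictMin hn]
  rw [h2, Finset.card_univ, Fintype.card_fin] at h1
  have hn' : (n : ℝ) ≠ 0 := by exact_mod_cast hn.ne'
  rw [hsum J ⟨0, hn⟩]
  rw [eq_div_iff hn', mul_assoc, mul_comm _ (n : ℝ), ← h1, mul_one]

/-- Some honest player has the strictly smallest value. -/
def HonestLeader (mal : Finset (Fin n)) (r : Fin n → BitString) : Prop :=
  ∃ p ∈ malᶜ, IsStrictMin r p

variable (mal : Finset (Fin n))

theorem measurableSet_honestLeader : MeasurableSet {r | HonestLeader mal r} := by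
  have : {r : Fin n → BitString | HonestLeader mal r} = ⋃ p ∈ malᶜ, {r | IsStrictMin r p} := by
    ext r
    simp [HonestLeader]
  rw [this]
  exact Finset.measurableSet_biUnion _ fun p _ => measurableSet_isStrictMin p

theorem rowLaw_honestLeader (hn : 0 < n) :
    (rowLaw n).real {r | HonestLeader mal r} = honestRatio mal :=
  rowLaw_isStrictMin_mem hn malᶜ

/-- The law of one independent uniform bit string for each counter and each player. -/
def rowsLaw (n : ℕ) : Measure (ℕ → Fin n → BitString) := Measure.infinitePi fun _ => rowLaw n

instance (n : ℕ) : IsProbabilityMeasure (rowsLaw n) := by unfold rowsLaw; infer_instance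

theorem measurePreserving_sigRows :
    MeasurePreserving (sigRows (n := n)) (oracleLaw n) (rowsLaw n) :=
  measurePreserving_rows uniformBits (e := fun γ j => Query.ofSig ⟨j, γ⟩)
    (by rintro ⟨a, b⟩ ⟨c, d⟩ h; simp_all [Function.uncurry])

theorem measurePreserving_hashRows :
    MeasurePreserving (hashRows (n := n)) (oracleLaw n) (rowsLaw n) :=
  measurePreserving_rows uniformBits (e := fun γ j => Query.ofHash ⟨j, γ⟩)
    (by rintro ⟨a, b⟩ ⟨c, d⟩ h; simp_all [Function.uncurry])

open Classical in
/-- The iterations before `W` in which some honest player has the strictly smallest value. -/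
def honestIterations (W : ℕ) (z : ℕ → Fin n → BitString) : Finset ℕ :=
  (Finset.range W).filter fun γ => HonestLeader mal (z γ)

-- Each iteration contributes a factor 1/2 or 1 depending only on its own row, so by independence
-- the expectation factorizes.
open Classical in
theorem half_pow_card_honestIterations (W : ℕ) (z : ℕ → Fin n → BitString) :
    (2⁻¹ : ℝ) ^ (honestIterations mal W z).card =
      ∏ γ : Fin W, ({r | HonestLeader mal r}.indicator (fun _ => -2⁻¹) (z γ) + 1) := by
  rw [← Finset.prod_range
      (f := fun γ => ({r | HonestLeader mal r}.indicator (fun _ => (-2⁻¹ : ℝ)) (z γ) + 1)),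
    honestIterations, ← Finset.prod_const, Finset.prod_filter]
  refine Finset.prod_congr rfl fun γ _ => ?_
  by_cases h : HonestLeader mal (z γ)
  · rw [if_pos h, Set.indicator_of_mem (by exact h)]
    norm_num
  · rw [if_neg h, Set.indicator_of_notMem (by exact h)]
    norm_num

theorem measurable_half_pow (W : ℕ) :
    Measurable fun z : ℕ → Fin n → BitString => (2⁻¹ : ℝ) ^ (honestIterations mal W z).card := by
  simp only [half_pow_card_honestIterations]
  refine Finset.measurable_fun_prod _ fun γ _ => Measurable.add_const ?_ _
  exact (measurable_const.indicator (measurableSet_honestLeader mal)).comp (measurable_pi_apply _)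

theorem integral_half_pow (hn : 0 < n) (W : ℕ) :
    ∫ z, (2⁻¹ : ℝ) ^ (honestIterations mal W z).card ∂rowsLaw n =
      (1 - honestRatio mal / 2) ^ W := by
  have hm : Measurable fun r : Fin n → BitString =>
      {r | HonestLeader mal r}.indicator (fun _ => (-2⁻¹ : ℝ)) r + 1 :=
    (measurable_const.indicator (measurableSet_honestLeader mal)).add_const 1
  have hind := (iIndepFun_infinitePi (P := fun _ : ℕ => rowLaw n)
    (X := fun _ r => {r | HonestLeader mal r}.indicator (fun _ => (-2⁻¹ : ℝ)) r + 1)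
    fun _ => hm).precomp (Fin.val_injective (n := W))
  simp only [half_pow_card_honestIterations]
  have h1 (γ : ℕ) : ∫ z, ({r | HonestLeader mal r}.indicator (fun _ => (-2⁻¹ : ℝ)) (z γ) + 1)
      ∂rowsLaw n = 1 - honestRatio mal / 2 := by
    have hint : Integrable ({r | HonestLeader mal r}.indicator (fun _ => (-2⁻¹ : ℝ)))
        (rowLaw n) := (integrable_const _).indicator (measurableSet_honestLeader mal)
    calc ∫ z, ({r | HonestLeader mal r}.indicator (fun _ => (-2⁻¹ : ℝ)) (z γ) + 1) ∂rowsLaw n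
        = ∫ r, ({r | HonestLeader mal r}.indicator (fun _ => (-2⁻¹ : ℝ)) r + 1) ∂rowLaw n := by
          rw [← Measure.infinitePi_map_eval (fun _ : ℕ => rowLaw n) γ,
            integral_map (measurable_pi_apply γ).aemeasurable hm.aestronglyMeasurable]
          rfl
      _ = 1 - honestRatio mal / 2 := by
          rw [integral_add hint (integrable_const 1), integral_indicator_const _
            (measurableSet_honestLeader mal), rowLaw_honestLeader mal hn]
          simp
          ring
  refine (iIndepFun.integral_fun_prod_eq_prod_integral hind fun γ =>
    (hm.comp (measurable_pi_apply _)).aestronglyMeasurable).trans ?_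
  refine (Finset.prod_congr rfl fun (γ : Fin W) _ => h1 γ).trans ?_
  simp

/-- Convexity of x^l on [0, ∞), applied to 1 - 2^{-K}: sharing leaders between components can only
help all of them to be settled together. -/
theorem jensen_honestIterations (hn : 0 < n) (W l : ℕ) :
    (1 - (1 - honestRatio mal / 2) ^ W) ^ l ≤
      ∫ z, (1 - (2⁻¹ : ℝ) ^ (honestIterations mal W z).card) ^ l ∂rowsLaw n := by
  have hm := measurable_half_pow mal W
  have hb (z : ℕ → Fin n → BitString) : (2⁻¹ : ℝ) ^ (honestIterations mal W z).card ∈ Set.Icc 0 1 :=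
    ⟨by positivity, pow_le_one₀ (by norm_num) (by norm_num)⟩
  have hi : Integrable (fun z => (2⁻¹ : ℝ) ^ (honestIterations mal W z).card) (rowsLaw n) :=
    Integrable.of_mem_Icc 0 1 hm.aemeasurable (.of_forall hb)
  have h := ConvexOn.map_integral_le (μ := rowsLaw n) (convexOn_pow (𝕜 := ℝ) l)
    (continuous_pow l).continuousOn isClosed_Ici
    (f := fun z => 1 - (2⁻¹ : ℝ) ^ (honestIterations mal W z).card)
    (.of_forall fun z => sub_nonneg.mpr (hb z).2) ((integrable_const 1).sub hi)
    (Integrable.of_mem_Icc 0 1 ((hm.const_sub 1).pow_const l).aemeasurable (.of_forall fun z =>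
      ⟨pow_nonneg (sub_nonneg.mpr (hb z).2) l,
        pow_le_one₀ (sub_nonneg.mpr (hb z).2) (by linarith [(hb z).1])⟩))
  rwa [integral_sub (integrable_const 1) hi, integral_half_pow mal hn, integral_const,
    probReal_univ, one_smul] at h

end

section

variable {n m : ℕ} {V S : Type*} [MeasurableSpace S]
  (mal : Finset (Fin n)) (init : Fin n → Fin m → Option V) (A : Strategy n m V S)

/-! ## Resampling the honest hashes of signatures -/

/-- The oracle that answers the queries `H σ`, for the honest signatures `σ`, as in `p.2` and all
other queries as in `p.1`. -/
def resample (p : Oracle n × (ℕ → Fin n → BitString)) : Oracle n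
  | .ofSig σ => p.1 (.ofSig σ)
  | .ofHash σ => if σ.signer ∈ mal then p.1 (.ofHash σ) else p.2 σ.counter σ.signer

theorem measurable_resample : Measurable (resample mal) := by
  refine measurable_pi_iff.mpr fun q => ?_
  cases q with
  | ofSig σ =>
    simp only [resample]
    fun_prop
  | ofHash σ =>
    simp only [resample]
    split_ifs <;> fun_prop

/-- Makes the honest `H (H σ)` a separate factor, independent of the private randomness and of the
other oracle answers. -/
theorem measurePreserving_resample :
    MeasurePreserving (resample mal) ((oracleLaw n).prod (rowsLaw n)) (oracleLaw n) := by
  classical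
  refine ⟨measurable_resample mal, ?_⟩
  have h := ((MeasurePreserving.id (oracleLaw n)).prod (measurePreserving_hashRows (n := n)))
  rw [← h.map_eq, Measure.map_map (measurable_resample mal) h.measurable]
  refine Eq.trans ?_ (measurePreserving_piecewise_infinitePi (fun _ : Query n => uniformBits)
    {q | ∃ σ, q = .ofHash σ ∧ σ.signer ∉ mal}).map_eq
  unfold oracleLaw
  congr 1
  funext p q
  cases q with
  | ofSig σ => simp [resample]
  | ofHash σ => by_cases hσ : σ.signer ∈ mal <;> simp [resample, hashRows, hσ]

/-- An honest signature visible in round 3γ + 3 satisfies 3 * counter + 4 ≤ 3γ + 3, so its counter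
is below γ; malicious hashes are not redrawn. -/
theorem known_resample_congr {γ : ℕ} {H : Oracle n} {z z' : ℕ → Fin n → BitString}
    (h : ∀ i < γ, z i = z' i) :
    known mal (3 * γ + 3) (resample mal (H, z)) = known mal (3 * γ + 3) (resample mal (H, z')) := by
  funext q
  cases q with
  | ofSig σ => simp [known, resample]
  | ofHash σ =>
    simp only [known]
    by_cases hσ : σ.signer ∈ mal
    · simp [hσ, resample]
    · by_cases hc : 3 * σ.counter + 4 ≤ 3 * γ + 3
      · simp [hσ, hc, resample, h σ.counter (by omega)]
      · simp [hσ, hc]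

/-! ## The bits of the leaders -/

theorem DiscretelyMeasurable.of_prop {Ω : Type*} [MeasurableSpace Ω] {f : Ω → Prop}
    (h : MeasurableSet {ω | f ω}) : DiscretelyMeasurable f := by
  refine of_singleton fun b => ?_
  by_cases hb : b
  · convert h using 1
    ext ω
    simp [hb]
  · convert h.compl using 1
    ext ω
    simp [hb]

open Classical in
/-- The honest player with the strictly smallest value, or `p₀` if there is none. -/
def leader (p₀ : Fin n) (r : Fin n → BitString) : Fin n :=
  if h : HonestLeader mal r then h.choose else p₀

theorem leader_spec {p₀ : Fin n} {r : Fin n → BitString} (h : HonestLeader mal r) :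
    leader mal p₀ r ∉ mal ∧ IsStrictMin r (leader mal p₀ r) := by
  unfold leader
  rw [dif_pos h]
  exact ⟨Finset.mem_compl.mp h.choose_spec.1, h.choose_spec.2⟩

theorem measurable_leader (p₀ : Fin n) : Measurable (leader mal p₀) := by
  have h : DiscretelyMeasurable fun (r : Fin n → BitString) => IsStrictMin r :=
    .pi fun p => .of_prop (measurableSet_isStrictMin p)
  refine (h.of_factors fun r r' he => ?_).measurable
  unfold leader HonestLeader
  rw [he]

/-- The bits by which the common coin is compared in iteration `γ`. -/
def targetBits (γ : ℕ) (ω : S × Oracle n) (c : ℕ) : Bool :=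
  -- The padding by `false` only serves to give a mask for the whole infinite string.
  if h : c < m then target mal init A ω γ ⟨c, h⟩ else false

theorem measurable_targetBits (hmal : 3 * mal.card < n) (γ : ℕ) :
    Measurable (targetBits mal init A γ) := by
  refine measurable_pi_iff.mpr fun c => ?_
  unfold targetBits
  split_ifs
  · exact measurable_target hmal γ _
  · exact measurable_const

/-- The bits of the hash `x p` of the honest leader `p` in iteration `γ`, compared with the target,
as a function of the outcome `b` and the honest hashes `z` of the earlier iterations. -/
def leaderBits (p₀ : Fin n) (γ : ℕ) (b : S × Oracle n) (z : ℕ → Fin n → BitString)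
    (x : Fin n → BitString) : BitString :=
  fun c => xor (x (leader mal p₀ (sigRows b.2 γ)) c)
    (targetBits mal init A γ (b.1, resample mal (b.2, z)) c)

theorem measurable_leaderBits (hmal : 3 * mal.card < n) (p₀ : Fin n) (γ : ℕ) :
    Measurable fun q : (S × Oracle n) × (ℕ → Fin n → BitString) × (Fin n → BitString) =>
      leaderBits mal init A p₀ γ q.1 q.2.1 q.2.2 := by
  have hxor : Measurable fun p : Bool × Bool => xor p.1 p.2 := .of_discrete
  have hev : Measurable fun p : (Fin n → BitString) × Fin n => p.1 p.2 :=
    measurable_from_prod_countable_left fun i => measurable_pi_apply i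
  have hsig : Measurable fun H : Oracle n => sigRows H γ :=
    (measurable_pi_apply γ).comp measurePreserving_sigRows.measurable
  have hlead := hev.comp ((measurable_snd.comp measurable_snd).prodMk
    (((measurable_leader mal p₀).comp hsig).comp (measurable_snd.comp measurable_fst)) :
    Measurable fun q : (S × Oracle n) × (ℕ → Fin n → BitString) × (Fin n → BitString) =>
      (q.2.2, leader mal p₀ (sigRows q.1.2 γ)))
  have htar := (measurable_targetBits mal init A hmal γ).comp
    ((measurable_fst.comp measurable_fst).prodMk ((measurable_resample mal).comp
      ((measurable_snd.comp measurable_fst).prodMk (measurable_fst.comp measurable_snd))) :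
      Measurable fun q : (S × Oracle n) × (ℕ → Fin n → BitString) × (Fin n → BitString) =>
        (q.1.1, resample mal (q.1.2, q.2.1)))
  exact measurable_pi_iff.mpr fun c => hxor.comp
    (((measurable_pi_apply c).comp hlead).prodMk ((measurable_pi_apply c).comp htar))

/-- The leader is a function of `b` alone, so a fixed coordinate of `x` is masked by a string that
does not depend on `x`. -/
theorem map_leaderBits (p₀ : Fin n) (γ : ℕ) (b : S × Oracle n) (z : ℕ → Fin n → BitString) :
    (rowLaw n).map (leaderBits mal init A p₀ γ b z) = uniformBits := by
  have hx : Measurable fun (x : BitString) (c : ℕ) =>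
      xor (x c) (targetBits mal init A γ (b.1, resample mal (b.2, z)) c) :=
    measurable_pi_iff.mpr fun c =>
      (Measurable.of_discrete (f := fun y : Bool => xor y _)).comp (measurable_pi_apply c)
  rw [← map_xor_uniformBits (targetBits mal init A γ (b.1, resample mal (b.2, z))),
    ← Measure.infinitePi_map_eval (fun _ : Fin n => uniformBits)
      (leader mal p₀ (sigRows b.2 γ)), Measure.map_map hx (measurable_pi_apply _)]
  rfl

/-- For each fixed `b` the bits are a predictable transform of the independent rows `z γ`; hence
they are independent of `b`, and in particular of which iterations have honest leaders. -/
theorem measurePreserving_leaderBits (hmal : 3 * mal.card < n) (p₀ : Fin n) (ν : Measure S)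
    [IsProbabilityMeasure ν] :
    MeasurePreserving
      (fun q : (S × Oracle n) × (ℕ → Fin n → BitString) =>
        (q.1, fun γ => leaderBits mal init A p₀ γ q.1 q.2 (q.2 γ)))
      ((ν.prod (oracleLaw n)).prod (rowsLaw n))
      ((ν.prod (oracleLaw n)).prod (Measure.infinitePi fun _ : ℕ => uniformBits)) := by
  have hm := measurable_leaderBits mal init A hmal p₀
  refine MeasurePreserving.skew_product (f := id)
    (g := fun b z γ => leaderBits mal init A p₀ γ b z (z γ)) (MeasurePreserving.id _)
    (measurable_pi_iff.mpr fun γ => (hm γ).comp (measurable_fst.prodMk (measurable_snd.prodMk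
      ((measurable_pi_apply γ).comp measurable_snd)))) (.of_forall fun b => ?_)
  refine (measurePreserving_predictable (rowLaw n) uniformBits
    (fun γ z x => leaderBits mal init A p₀ γ b z x) (fun γ => (hm γ).comp measurable_prodMk_left)
    (fun γ z z' h => ?_) fun γ z => map_leaderBits mal init A p₀ γ b z).map_eq
  funext x c
  simp only [leaderBits, targetBits]
  rw [target_congr (γ := γ) (ω := (b.1, resample mal (b.2, z)))
    (ω' := (b.1, resample mal (b.2, z'))) rfl (known_resample_congr mal h)]

/-! ## The probability that all ambiguous components are settled -/

/-- Before iteration `W`, for each ambiguous component there has been an iteration with an honest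
leader whose bit makes the honest players agree. -/
def settled (W : ℕ) : Set (S × Oracle n) :=
  {ω | ∀ c ∈ ambiguous mal init, ∃ γ < W, ∃ p, p ∉ mal ∧ IsStrictMin (sigRows ω.2 γ) p ∧
    hashRows ω.2 γ p c = target mal init A ω γ c}

theorem measurableSet_settled (hmal : 3 * mal.card < n) (W : ℕ) :
    MeasurableSet (settled mal init A W) := by
  have : settled mal init A W = ⋂ c ∈ ambiguous mal init, ⋃ γ : ℕ, ⋃ _ : γ < W, ⋃ p : Fin n,
      ⋃ _ : p ∉ mal, {ω : S × Oracle n | IsStrictMin (sigRows ω.2 γ) p} ∩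
        {ω | hashRows ω.2 γ p c = target mal init A ω γ c} := by
    ext ω
    simp [settled, and_left_comm]
  rw [this]
  refine MeasurableSet.biInter (Set.to_countable _) fun c _ => MeasurableSet.iUnion fun γ =>
    MeasurableSet.iUnion fun _ => MeasurableSet.iUnion fun p => MeasurableSet.iUnion fun _ =>
    MeasurableSet.inter ?_ ?_
  · exact (((measurable_pi_apply γ).comp measurePreserving_sigRows.measurable).comp
      measurable_snd) (measurableSet_isStrictMin p)
  · exact measurableSet_eq_fun ((measurable_pi_apply (c : ℕ)).comp ((measurable_pi_apply
      (Query.ofHash ⟨p, γ⟩)).comp measurable_snd)) (measurable_target hmal γ c)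

theorem one_sub_half_pow_eq_ofReal (k l : ℕ) :
    (1 - (2⁻¹ : ENNReal) ^ k) ^ l = ENNReal.ofReal ((1 - (2⁻¹ : ℝ) ^ k) ^ l) := by
  rw [ENNReal.ofReal_pow (sub_nonneg.mpr (pow_le_one₀ (by norm_num) (by norm_num))),
    ENNReal.ofReal_sub _ (by positivity), ENNReal.ofReal_pow (by norm_num),
    ENNReal.ofReal_inv_of_pos (by norm_num)]
  simp

theorem lintegral_honestIterations (hn : 0 < n) (W l : ℕ) :
    ENNReal.ofReal ((1 - (1 - honestRatio mal / 2) ^ W) ^ l) ≤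
      ∫⁻ z, (1 - 2⁻¹ ^ (honestIterations mal W z).card) ^ l ∂rowsLaw n := by
  have hb (z : ℕ → Fin n → BitString) : 0 ≤ 1 - (2⁻¹ : ℝ) ^ (honestIterations mal W z).card :=
    sub_nonneg.mpr (pow_le_one₀ (by norm_num) (by norm_num))
  have hm := ((measurable_half_pow mal W).const_sub 1).pow_const l
  refine (ENNReal.ofReal_le_ofReal (jensen_honestIterations mal hn W l)).trans ?_
  simp only [one_sub_half_pow_eq_ofReal]
  rw [ofReal_integral_eq_lintegral_ofReal]
  · exact Integrable.of_mem_Icc 0 1 hm.aemeasurable (.of_forall fun z => ⟨pow_nonneg (hb z) l,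
      pow_le_one₀ (hb z) (sub_le_self _ (by positivity))⟩)
  · exact .of_forall fun z => pow_nonneg (hb z) l

theorem le_measure_settled (hmal : 3 * mal.card < n) (ν : Measure S) [IsProbabilityMeasure ν]
    (W : ℕ) :
    ENNReal.ofReal ((1 - (1 - honestRatio mal / 2) ^ W) ^ numAmbiguous mal init) ≤
      (ν.prod (oracleLaw n)) (settled mal init A W) := by
  classical
  have hn : 0 < n := by omega
  let p₀ : Fin n := ⟨0, hn⟩
  -- Components become positions in infinite bit strings.
  let C : Finset ℕ := (ambiguous mal init).toFinset.image Fin.val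
  have hC : C.card = numAmbiguous mal init := by
    rw [Finset.card_image_of_injective _ Fin.val_injective]
    exact (Set.ncard_eq_toFinset_card' (ambiguous mal init)).symm
  let E : Set ((S × Oracle n) × (ℕ → BitString)) :=
    {q | ∀ c ∈ C, ∃ γ ∈ honestIterations mal W (sigRows q.1.2), q.2 γ c = false}
  have hE : MeasurableSet E := by
    have : E = ⋂ c ∈ C, ⋃ γ ∈ Finset.range W,
        {q | HonestLeader mal (sigRows q.1.2 γ)} ∩ {q | q.2 γ c = false} := by
      ext q
      simp [E, honestIterations, and_assoc, and_left_comm]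
    rw [this]
    refine Finset.measurableSet_biInter _ fun c _ => Finset.measurableSet_biUnion _ fun γ _ =>
      MeasurableSet.inter ?_ ?_
    · exact (((measurable_pi_apply γ).comp measurePreserving_sigRows.measurable).comp
        (measurable_snd.comp measurable_fst)) (measurableSet_honestLeader mal)
    · exact measurableSet_eq_fun ((measurable_pi_apply c).comp ((measurable_pi_apply γ).comp
        measurable_snd)) measurable_const
  have hJ : MeasurePreserving
      (fun q : (S × Oracle n) × (ℕ → Fin n → BitString) => (q.1.1, resample mal (q.1.2, q.2)))
      ((ν.prod (oracleLaw n)).prod (rowsLaw n)) (ν.prod (oracleLaw n)) :=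
    ((MeasurePreserving.id ν).prod (measurePreserving_resample mal)).comp
      (measurePreserving_prodAssoc ν (oracleLaw n) (rowsLaw n))
  have hK := measurePreserving_leaderBits mal init A hmal p₀ ν
  have hsig := (measurePreserving_sigRows (n := n)).comp
    (measurePreserving_snd (μ := ν) (ν := oracleLaw n))
  have hmg : Measurable fun z : ℕ → Fin n → BitString =>
      (1 - (2⁻¹ : ENNReal) ^ (honestIterations mal W z).card) ^ numAmbiguous mal init := by
    simp only [one_sub_half_pow_eq_ofReal]
    exact (((measurable_half_pow mal W).const_sub 1).pow_const _).ennreal_ofReal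
  rw [← hJ.measure_preimage (measurableSet_settled mal init A hmal W).nullMeasurableSet]
  calc ENNReal.ofReal ((1 - (1 - honestRatio mal / 2) ^ W) ^ numAmbiguous mal init)
      ≤ ∫⁻ z, (1 - 2⁻¹ ^ (honestIterations mal W z).card) ^ numAmbiguous mal init ∂rowsLaw n :=
        lintegral_honestIterations mal hn W _
    _ = ∫⁻ b, (1 - 2⁻¹ ^ (honestIterations mal W (sigRows b.2)).card) ^ numAmbiguous mal init
          ∂ν.prod (oracleLaw n) := (hsig.lintegral_comp hmg).symm
    _ = ((ν.prod (oracleLaw n)).prod (Measure.infinitePi fun _ : ℕ => uniformBits)) E := by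
        rw [Measure.prod_apply hE]
        refine lintegral_congr fun b => ?_
        have := infinitePi_columns fairBit (honestIterations mal W (sigRows b.2)) C false
        rw [fairBit_singleton, hC] at this
        exact this.symm
    _ = _ := (hK.measure_preimage hE.nullMeasurableSet).symm
    _ ≤ _ := by
        refine measure_mono fun q hq c hc => ?_
        obtain ⟨γ, hγ, hbit⟩ := hq c (Finset.mem_image_of_mem _ (Set.mem_toFinset.mpr hc))
        simp only [honestIterations, Finset.mem_filter, Finset.mem_range] at hγ
        obtain ⟨hlm, hls⟩ := leader_spec mal (p₀ := p₀) hγ.2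
        refine ⟨γ, hγ.1, leader mal p₀ (sigRows q.1.2 γ), hlm, hls, ?_⟩
        -- A vanishing XOR says that the bit equals the target; since the leader is honest, its hash
        -- is the redrawn one.
        simpa [leaderBits, targetBits, hashRows, resample, hlm] using hbit

theorem commSteps_le_of_settled (hmal : 3 * mal.card < n) {W : ℕ} {ω : S × Oracle n}
    (h : ω ∈ settled mal init A W) : commSteps mal init A ω ≤ ((5 + 3 * W : ℕ) : ℕ∞) :=
  commSteps_le_of_coins hmal h

theorem five_add_le_iff {x : ℕ∞} {k W : ℕ} (hk : 5 + 3 * W ≤ k) (hk' : k < 5 + 3 * W + 3) :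
    5 + 3 * x ≤ k ↔ x ≤ W := by
  induction x using ENat.recTopCoe with
  | top => simp
  | coe x =>
    norm_cast
    omega

end

end MBA

end

/-! ### The stochastic bound -/

theorem mainTheorem5 {V S : Type*} [MeasurableSpace S] (n m : ℕ)
    (mal : Finset (Fin n)) (hmal : 3 * mal.card < n)
    (init : Fin n → Fin m → Option V)
    (ν : MeasureTheory.Measure S) [MeasureTheory.IsProbabilityMeasure ν]
    (A : MBA.Strategy n m V S) :
    MBA.StochBoundedBy
      (MBA.commSteps mal init A) (ν.prod (MBA.oracleLaw n))
      (fun x => 5 + 3 * MBA.chi x)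
      (MBA.flipLaw (MBA.numAmbiguous mal init)
        ⟨MBA.honestRatio mal / 2, MBA.honestRatio_half_mem mal⟩) := by
  have hprob (l : ℕ) (p : unitInterval) : MeasureTheory.IsProbabilityMeasure (MBA.flipLaw l p) := by
    unfold MBA.flipLaw
    infer_instance
  intro k
  induction k using ENat.recTopCoe with
  | top => simp
  | coe k =>
    -- Below 5 the right-hand probability is 1.
    by_cases hk : k < 5
    · refine MeasureTheory.prob_le_one.trans (le_of_eq ?_)
      rw [← MeasureTheory.measure_univ (μ := MBA.flipLaw (MBA.numAmbiguous mal init)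
        ⟨MBA.honestRatio mal / 2, MBA.honestRatio_half_mem mal⟩)]
      congr 1
      refine (Set.eq_univ_of_forall fun x => ?_).symm
      exact lt_of_lt_of_le (b := (5 : ℕ∞)) (by exact_mod_cast hk) le_self_add
    -- The finite values of 5 + 3χ have the form 5 + 3W, so only the largest such value up to `k`
    -- matters.
    · obtain ⟨W, hW, hW'⟩ : ∃ W, 5 + 3 * W ≤ k ∧ k < 5 + 3 * W + 3 :=
        ⟨(k - 5) / 3, by omega, by omega⟩
      have hset : {x : MBA.Flips (MBA.numAmbiguous mal init) | (k : ℕ∞) < 5 + 3 * MBA.chi x} =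
          {x | MBA.chi x ≤ W}ᶜ := by
        ext x
        rw [Set.mem_compl_iff, Set.mem_ofPred_eq, Set.mem_ofPred_eq,
          ← MBA.five_add_le_iff hW hW', not_le]
      have hmeas : MeasurableSet {x : MBA.Flips (MBA.numAmbiguous mal init) | MBA.chi x ≤ W} := by
        simp only [MBA.chi_le_iff, Set.ofPred_forall, Set.ofPred_exists]
        exact MeasurableSet.iInter fun c => MeasurableSet.iUnion fun γ => (MeasurableSet.const _).inter
          (measurableSet_eq_fun ((measurable_pi_apply c).comp (measurable_pi_apply γ))
            measurable_const)
      calc (ν.prod (MBA.oracleLaw n)) {ω | (k : ℕ∞) < MBA.commSteps mal init A ω}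
          ≤ (ν.prod (MBA.oracleLaw n)) (MBA.settled mal init A W)ᶜ := by
            refine MeasureTheory.measure_mono fun ω hω hs => ?_
            have h1 := MBA.commSteps_le_of_settled mal init A hmal hs
            exact absurd (lt_of_lt_of_le hω h1) (not_lt.mpr (by exact_mod_cast hW))
        _ ≤ 1 - ENNReal.ofReal ((1 - (1 - MBA.honestRatio mal / 2) ^ W) ^
              MBA.numAmbiguous mal init) := by
            rw [MeasureTheory.prob_compl_eq_one_sub (MBA.measurableSet_settled mal init A hmal W)]
            exact tsub_le_tsub_left (MBA.le_measure_settled mal init A hmal ν W) 1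
        _ = _ := by
            rw [hset, MeasureTheory.prob_compl_eq_one_sub hmeas, MBA.flipLaw_chi_le]
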